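/- **Setting.** Let $\mathbb T=\mathbb R/2\pi\mathbb Z$ with Haar probability measure $\mu$, $H=L^2(\mu)$, $\phi_j(\theta)=e^{ij\theta}$. Fix $p\in(0,1)$ and $\alpha\neq 0$; let $\Phi^t(\theta)=\theta+\alpha t \bmod 2\pi$, $U^tg=g\circ\Phi^t$, and let $V$ be the generator of $U^t$ on $H$, $Vg=\lim_{t\to0}(U^tg-g)/t$. *Function spaces.* For $\tau>0$ let $\lambda_\tau(j)=e^{-\tau|j|^p}$ ($j\in\mathbb Z$), let $\mathcal H_\tau$ be the reproducing kernel Hilbert space on $\mathbb T$ with kernel $k_\tau(x,y)=\sum_j\lambda_\tau(j)\overline{\phi_j(x)}\phi_j(y)$, with orthonormal basis $\psi_j=\sqrt{\lambda_\tau(j)}\,\phi_j$, and let $K_\tau:H\to\mathcal H_\tau$, $K_\tau u=\int k_\tau(\cdot,y)u(y)\,d\mu(y)$; its adjoint $K_\tau^*$ is the restriction map $\mathcal H_\tau\to H$. Let $F(\mathcal H_\tau)=\mathbb C\oplus\mathcal H_\tau\oplus\mathcal H_\tau^{\otimes2}\oplus\cdots$ be the (full) Fock space, and let $\Delta_{n-1}:\mathcal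 H_\tau\to\mathcal H_\tau^{\otimes n}\subset F(\mathcal H_\tau)$ be the bounded linear extension of $k_x\mapsto k_x^{\otimes n}$, where $k_x=k_\tau(x,\cdot)$. *Regularized dynamics.* Let $W_\tau=K_\tau VK_\tau^*$. For $m\in\mathbb N$ let $\mathcal H_{\tau,m}$ be the span of the first $m$ of $\psi_0,\psi_1,\psi_{-1},\psi_2,\psi_{-2},\dots$, let $W_{\tau,m}$ be the compression of $W_\tau$ to $\mathcal H_{\tau,m}$, $U^t_{\tau,m}=e^{tW_{\tau,m}}$, and let $\tilde U^t_{\tau,m}$ be its lift to the Fock space, $g_1\otimes\cdots\otimes g_n\mapsto U^t_{\tau,m}g_1\otimes\cdots\otimes U^t_{\tau,m}g_n$. Let $\zeta_{0},\dots,\zeta_{m-1}$ (depending on $\tau$) be any orthonormal basis of $\mathcal H_{\tau,m}$ that consists of eigenvectors of $W_{\tau,m}$ and is ordered by nondecreasing Dirichlet energy, where the energy of $\sum_ic_i\psi_i$ is $\sum_i|c_i|^2\lambda_\tau(i)^{-1}/\sum_i|c_i|^2-1$. For $2d+1\le m$ let $Z_{\tau,d,m}$ be the orthogonal projection of $\mathcal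 H_\tau$ onto $\operatorname{span}\{\zeta_0,\dots,\zeta_{2d}\}$. *States and observables.* For $\kappa>0$ let $\sigma_{\theta,\kappa}(x)=e^{\kappa\cos(x-\theta)}/I_0(\kappa)$ be the von Mises density ($I_0$ the modified Bessel function) and $\xi=\sigma_{\theta,\kappa}/\|\sigma_{\theta,\kappa}\|_{\mathcal H_\tau}$. Given weights $w_n>0$ with $\sum_{n\ge1}w_n=1$, put $$\eta=\sum_{n\ge1}w_n\,\xi_n^{\otimes n},\qquad \xi_n=\frac{Z_{\tau,d,m}\,\xi^{1/n}}{\|Z_{\tau,d,m}\,\xi^{1/n}\|_{\mathcal H_\tau}},\qquad \nu=\langle\eta,\cdot\rangle\eta .$$ For $f\in L^\infty(\mathbb T)$ let $M_f$ be multiplication by $f$ on $H$ and $A_{f,\tau,n}=\Delta_{n-1}K_\tau M_fK_\tau^*\Delta_{n-1}^*$. With $\tilde{\mathcal P}^t_{\tau,m}\rho=\tilde U^{t*}_{\tau,m}\,\rho\,\tilde U^{t}_{\tau,m}$ and $\mathbb E_\rho A=\operatorname{tr}(\rho A)$, the Fock space prediction is $$\tilde f^{(t)}_{\kappa,\tau,n,d,m}(\theta)=\frac{\mathbb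 E_{\tilde{\mathcal P}^t_{\tau,m}\nu}\,A_{f,\tau,n}}{\mathbb E_{\tilde{\mathcal P}^t_{\tau,m}\nu}\,A_{1,\tau,n}} .$$ **Theorem.** For every $f\in L^\infty(\mathbb T)$ there are constants $c_1,c_2>0$ such that, for all $t\in\mathbb R$, $\kappa>0$, $m\ge5$ held fixed (and all choices of the weights $w$ and of the eigenbases $\zeta$ as above), and for every $\theta\in\mathbb T$, with $d=2$, $n=\lceil c_1/\varepsilon\rceil$ and $\tau=c_2\varepsilon^2$, $$\lim_{\varepsilon\to0^+}\tilde f^{(t)}_{\kappa,\tau,n,d,m}(\theta)=\mathbb E_{p_{\theta,2\kappa}}(U^tf)=\int_{\mathbb T}f(\Phi^t(x))\,\sigma_{\theta,2\kappa}(x)\,d\mu(x).$$ -/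

import Mathlib

open MeasureTheory Filter Topology InnerProductSpace
open scoped ENNReal Real

noncomputable section

namespace FockKoopman

/-- The circle `ℝ / 2πℤ`. -/
abbrev Circ : Type := AddCircle (2 * π)

instance factTwoPiPos : Fact (0 < 2 * π) := ⟨Real.two_pi_pos⟩

/-- The Haar probability measure of the circle. -/
abbrev haar : Measure Circ := AddCircle.haarAddCircle

/-- The positive real numbers. -/
abbrev PosReal : Type := {x : ℝ // 0 < x}

/-- The exponents `p ∈ (0, 1)` of the subexponential weights. -/
abbrev Exponent : Type := Set.Ioo (0 : ℝ) 1

/-- The subexponential weights `λ_τ(j) = exp (-τ |j|^p)`. -/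
def weight (p : Exponent) (τ : PosReal) (j : ℤ) : ℝ :=
  Real.exp (-(τ : ℝ) * |(j : ℝ)| ^ (p : ℝ))

theorem weight_pos (p : Exponent) (τ : PosReal) (j : ℤ) : 0 < weight p τ j := Real.exp_pos _

theorem summable_weight (p : Exponent) (τ : PosReal) : Summable (weight p τ) := by
  have key : Summable (fun n : ℕ => weight p τ (n : ℤ)) := by
    have hp : 0 < (p : ℝ) := p.2.1
    have h1 := (isLittleO_exp_neg_mul_rpow_atTop τ.2 (-2 / (p : ℝ)))
    have h2 : Tendsto (fun n : ℕ => ((n : ℝ)) ^ (p : ℝ)) atTop atTop :=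
      (tendsto_rpow_atTop hp).comp tendsto_natCast_atTop_atTop
    have h3 := (h1.comp_tendsto h2).isBigO
    refine summable_of_isBigO_nat (g := fun n : ℕ => ((n : ℝ)) ^ (-2 : ℝ))
      (Real.summable_nat_rpow.2 (by norm_num)) ?_
    refine (h3.congr' ?_ ?_)
    · filter_upwards with n
      simp [weight]
    · filter_upwards with n
      simp only [Function.comp]
      rw [← Real.rpow_mul (Nat.cast_nonneg n)]
      congr 1
      field_simp
  refine Summable.of_nat_of_neg key ?_
  refine key.congr fun n => ?_
  simp [weight]

theorem summable_sqrt_weight (p : Exponent) (τ : PosReal) :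
    Summable fun j => √(weight p τ j) := by
  refine (summable_weight p ⟨τ / 2, half_pos τ.2⟩).congr fun j => ?_
  rw [weight, weight, ← Real.exp_half]
  congr 1
  ring

/-! ### The reproducing kernel Hilbert algebra -/

/-- The reproducing kernel Hilbert space `H_τ` on the circle with the kernel
`k_τ(x, y) = ∑_j λ_τ(j) conj (e^{ijx}) e^{ijy}`. An element is stored through its coordinates in the
orthonormal basis `ψ_j = √λ_τ(j) e^{ij·}`; the function that it represents is `toCont` below, the
structure of a reproducing kernel Hilbert space is `instRKHS`, and `kernelSection_apply` computes
the kernel. -/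
def RKHA (_p : Exponent) (_τ : PosReal) : Type := lp (fun _ : ℤ => ℂ) 2

variable (p : Exponent) (τ : PosReal)

instance : NormedAddCommGroup (RKHA p τ) :=
  inferInstanceAs (NormedAddCommGroup (lp (fun _ : ℤ => ℂ) 2))
instance : InnerProductSpace ℂ (RKHA p τ) :=
  inferInstanceAs (InnerProductSpace ℂ (lp (fun _ : ℤ => ℂ) 2))
instance : CompleteSpace (RKHA p τ) :=
  inferInstanceAs (CompleteSpace (lp (fun _ : ℤ => ℂ) 2))

variable {p τ}

/-- The coordinate of an element of `H_τ` along `ψ_j`. -/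
def RKHA.coord (g : RKHA p τ) (j : ℤ) : ℂ := (show lp (fun _ : ℤ => ℂ) 2 from g) j

theorem RKHA.coord_add (g h : RKHA p τ) (j : ℤ) : (g + h).coord j = g.coord j + h.coord j := rfl

theorem RKHA.coord_smul (c : ℂ) (g : RKHA p τ) (j : ℤ) : (c • g).coord j = c * g.coord j := rfl

theorem RKHA.norm_coord_le (g : RKHA p τ) (j : ℤ) : ‖g.coord j‖ ≤ ‖g‖ :=
  lp.norm_apply_le_norm (by norm_num) (show lp (fun _ : ℤ => ℂ) 2 from g) j

theorem RKHA.norm_term_le (g : RKHA p τ) (j : ℤ) :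
    ‖(g.coord j * (√(weight p τ j) : ℂ)) • fourier (T := 2 * π) j‖ ≤ ‖g‖ * √(weight p τ j) := by
  rw [norm_smul, fourier_norm, mul_one, norm_mul, Complex.norm_real,
    Real.norm_of_nonneg (Real.sqrt_nonneg _)]
  exact mul_le_mul_of_nonneg_right (g.norm_coord_le j) (Real.sqrt_nonneg _)

theorem RKHA.summable_term (g : RKHA p τ) :
    Summable fun j : ℤ => (g.coord j * (√(weight p τ j) : ℂ)) • fourier (T := 2 * π) j :=
  Summable.of_norm_bounded ((summable_sqrt_weight p τ).mul_left ‖g‖) g.norm_term_le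

theorem RKHA.norm_sq_hasSum (g : RKHA p τ) :
    HasSum (fun j : ℤ => ‖g.coord j‖ ^ 2) (‖g‖ ^ 2) := by
  have h := lp.hasSum_inner (𝕜 := ℂ) (show lp (fun _ : ℤ => ℂ) 2 from g)
    (show lp (fun _ : ℤ => ℂ) 2 from g)
  convert Complex.hasSum_re h using 1
  · funext j
    exact (inner_self_eq_norm_sq (𝕜 := ℂ) (g.coord j)).symm
  · exact (inner_self_eq_norm_sq (𝕜 := ℂ) g).symm

/-- The inclusion `H_τ → C(𝕋)`: `g ↦ ∑_j (coordinate of g along ψ_j) √λ_τ(j) e^{ij·}`. -/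
def toCont : RKHA p τ →L[ℂ] C(Circ, ℂ) :=
  LinearMap.mkContinuous
    { toFun := fun g => ∑' j : ℤ, (g.coord j * (√(weight p τ j) : ℂ)) • fourier j
      map_add' := fun g h => by
        rw [← g.summable_term.tsum_add h.summable_term]
        refine tsum_congr fun j => ?_
        rw [← add_smul, ← add_mul, RKHA.coord_add]
      map_smul' := fun c g => by
        rw [RingHom.id_apply, ← g.summable_term.tsum_const_smul c]
        refine tsum_congr fun j => ?_
        rw [smul_smul, ← mul_assoc, RKHA.coord_smul] }
    (∑' j, √(weight p τ j))
    (fun g => by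
      have h := tsum_of_norm_bounded ((summable_sqrt_weight p τ).mul_left ‖g‖).hasSum
        g.norm_term_le
      exact h.trans_eq (tsum_mul_left.trans (mul_comm _ _)))

theorem toCont_apply (g : RKHA p τ) (x : Circ) :
    toCont g x = ∑' j : ℤ, g.coord j * (√(weight p τ j) : ℂ) * fourier j x := by
  have h := ((ContinuousMap.evalCLM ℂ x).hasSum g.summable_term.hasSum).tsum_eq
  exact h.symm

theorem fourierCoeff_toCont (g : RKHA p τ) (j : ℤ) :
    fourierCoeff (toCont g) j = g.coord j * (√(weight p τ j) : ℂ) := by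
  let L : C(Circ, ℂ) →L[ℂ] ℂ := 
    (innerSL ℂ (fourierLp 2 j : Lp ℂ 2 haar)) ∘L (ContinuousMap.toLp 2 haar ℂ)
  have hL : ∀ F : C(Circ, ℂ), L F = fourierCoeff F j := fun F => by
    rw [← fourierCoeff_toLp, ← fourierBasis_repr, HilbertBasis.repr_apply_apply, coe_fourierBasis]
    rfl
  have hF : ∀ k : ℤ, L (fourier k) = if k = j then 1 else 0 := fun k => by
    have := (orthonormal_iff_ite.1 (orthonormal_fourier (T := 2 * π))) j k
    simp only [eq_comm (a := k)]
    exact this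
  rw [← hL]
  have h := (L.hasSum g.summable_term.hasSum).tsum_eq
  refine h.symm.trans ?_
  simp_rw [map_smul, hF]
  simp

/-- Elements of `H_τ` are functions on the circle, with continuous point evaluations. -/
instance instRKHS : RKHS ℂ (RKHA p τ) Circ ℂ where
  coeCLM := (ContinuousLinearMap.pi fun x => ContinuousMap.evalCLM ℂ x) ∘L toCont
  coeCLM_injective := by
    intro g h hgh
    have h1 : toCont g = toCont h := ContinuousMap.ext fun x => congrFun hgh x
    refine lp.ext (funext fun j => ?_)
    have h2 := fourierCoeff_toCont g j
    rw [h1, fourierCoeff_toCont] at h2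
    exact (mul_right_cancel₀ (by
      exact_mod_cast (Real.sqrt_pos.2 (weight_pos p τ j)).ne') h2).symm

/-- The kernel section `k_x = k_τ(x, ·)`, that is, the Riesz representative of evaluation at `x`. -/
def kernelSection (p : Exponent) (τ : PosReal) (x : Circ) : RKHA p τ :=
  RKHS.kerFun (RKHA p τ) x (1 : ℂ)

/-- The orthonormal basis `ψ_j = √λ_τ(j) e^{ij·}` of `H_τ` (see `psi_apply`). -/
def psi (p : Exponent) (τ : PosReal) (j : ℤ) : RKHA p τ :=
  (show RKHA p τ from lp.single (E := fun _ : ℤ => ℂ) 2 j (1 : ℂ))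

theorem coord_psi (j k : ℤ) : (psi p τ j).coord k = if k = j then 1 else 0 := by
  change (lp.single (E := fun _ : ℤ => ℂ) 2 j (1 : ℂ)) k = _
  rw [lp.single_apply]
  by_cases h : k = j
  · subst h; simp
  · simp [h]

theorem inner_psi (j : ℤ) (g : RKHA p τ) : ⟪psi p τ j, g⟫_ℂ = g.coord j := by
  have := lp.inner_single_left (𝕜 := ℂ) (G := fun _ : ℤ => ℂ) j (1 : ℂ) (show lp (fun _ : ℤ => ℂ) 2 from g)
  refine this.trans ?_
  simp
  rfl

theorem psi_apply (j : ℤ) (x : Circ) :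
    psi p τ j x = (√(weight p τ j) : ℂ) * fourier j x := by
  refine (toCont_apply _ x).trans ?_
  rw [tsum_eq_single j]
  · simp [coord_psi]
  · intro k hk
    simp [coord_psi, hk]

theorem kernelSection_apply (x y : Circ) :
    kernelSection p τ x y =
      ∑' j : ℤ, (weight p τ j : ℂ) * (starRingEnd ℂ (fourier j x) * fourier j y) := by
  refine (toCont_apply _ y).trans (tsum_congr fun j => ?_)
  have h : (kernelSection p τ x).coord j = starRingEnd ℂ ((√(weight p τ j) : ℂ) * fourier j x) := by
    rw [← inner_psi, kernelSection, RKHS.inner_kerFun, psi_apply]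
    simp
  rw [h, map_mul, Complex.conj_ofReal]
  have h2 : (weight p τ j : ℂ) = (√(weight p τ j) : ℂ) * (√(weight p τ j) : ℂ) := by
    rw [← Complex.ofReal_mul, Real.mul_self_sqrt (weight_pos p τ j).le]
  rw [h2]
  ring

/-! ### The operators `K_τ`, the Koopman group and its regularized generator -/

/-- The restriction map `K_τ^* : H_τ → L²(𝕋)`, a function being sent to its class. -/
def restrictOp (p : Exponent) (τ : PosReal) : RKHA p τ →L[ℂ] Lp ℂ 2 haar :=
  (ContinuousMap.toLp 2 haar ℂ) ∘L toCont

/-- The operator `K_τ : L²(𝕋) → H_τ`, `K_τ u = ∫ k_τ(·, y) u(y) dy` (see `kernelOp_apply`). -/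
def kernelOp (p : Exponent) (τ : PosReal) : Lp ℂ 2 haar →L[ℂ] RKHA p τ :=
  ContinuousLinearMap.adjoint (restrictOp p τ)

theorem kernelOp_apply (u : Lp ℂ 2 haar) (x : Circ) :
    kernelOp p τ u x = ∫ y, kernelSection p τ y x * u y ∂haar := by
  have h1 : kernelOp p τ u x = ⟪kernelSection p τ x, kernelOp p τ u⟫_ℂ := by
    simp [kernelSection]
  rw [h1, kernelOp, ContinuousLinearMap.adjoint_inner_right, L2.inner_def]
  refine integral_congr_ae ?_
  filter_upwards [ContinuousMap.coeFn_toLp (p := 2) (𝕜 := ℂ) haar (toCont (kernelSection p τ x))] with y hy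
  change ⟪(ContinuousMap.toLp 2 haar ℂ (toCont (kernelSection p τ x)) : Lp ℂ 2 haar) y, u y⟫_ℂ = _
  rw [hy]
  have h2 : toCont (kernelSection p τ x) y = starRingEnd ℂ (kernelSection p τ y x) := by
    have e1 : toCont (kernelSection p τ x) y = ⟪kernelSection p τ y, kernelSection p τ x⟫_ℂ := by
      refine Eq.trans ?_ (RKHS.kerFun_inner y (1 : ℂ) (kernelSection p τ x)).symm
      simp
      rfl
    have e2 : kernelSection p τ y x = ⟪kernelSection p τ x, kernelSection p τ y⟫_ℂ := by
      rw [kernelSection, kernelSection, RKHS.kerFun_inner]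
      simp
    rw [e1, e2, inner_conj_symm]
  rw [h2]
  simp [mul_comm]

/-- The circle rotation `Φ^t(θ) = θ + αt mod 2π`. -/
def flow (α t : ℝ) (θ : Circ) : Circ := θ + ((α * t : ℝ) : Circ)

theorem measurePreserving_flow (α t : ℝ) : MeasurePreserving (flow α t) haar haar :=
  measurePreserving_add_right haar _

/-- The Koopman operator `U^t g = g ∘ Φ^t` on `L^q(𝕋)`. -/
def koopman {q : ℝ≥0∞} (α t : ℝ) (g : Lp ℂ q haar) : Lp ℂ q haar :=
  Lp.compMeasurePreserving (flow α t) (measurePreserving_flow α t) g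

/-- The generator `V g = lim_{t → 0} (U^t g - g) / t` of the Koopman group on `L²(𝕋)`. It is only
meaningful on the `g` for which the limit exists. -/
def generator (α : ℝ) (g : Lp ℂ 2 haar) : Lp ℂ 2 haar :=
  deriv (fun t : ℝ => koopman α t g) 0

/-- The regularized generator `W_τ = K_τ V K_τ^*` on `H_τ`. By the polar decomposition
`K_τ = T_τ (K_τ^* K_τ)^{1/2}` it is `T_τ V_τ T_τ^*`, where `V_τ = (K_τ^* K_τ)^{1/2} V (K_τ^* K_τ)^{1/2}`
is the compactified generator on `L²(𝕋)`. -/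
def WOp (p : Exponent) (τ : PosReal) (α : ℝ) (g : RKHA p τ) : RKHA p τ :=
  kernelOp p τ (generator α (restrictOp p τ g))

/-- The enumeration `0, 1, -1, 2, -2, …` of the frequencies, in order of decreasing weight. -/
def freq (i : ℕ) : ℤ := if Even i then -((i / 2 : ℕ) : ℤ) else (((i + 1) / 2 : ℕ) : ℤ)

/-- The compression `W_{τ,m}` of `W_τ` to `H_{τ,m} = span {ψ_{freq i} | i < m}`, through its matrix
elements. -/
def WFin (p : Exponent) (τ : PosReal) (α : ℝ) (m : ℕ) : RKHA p τ →L[ℂ] RKHA p τ :=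
  ∑ i ∈ Finset.range m, ∑ j ∈ Finset.range m,
    ⟪psi p τ (freq i), WOp p τ α (psi p τ (freq j))⟫_ℂ •
      rankOne ℂ (psi p τ (freq i)) (psi p τ (freq j))

/-- The evolution operator `U^t_{τ,m} = exp (t W_{τ,m})`. -/
def UFin (p : Exponent) (τ : PosReal) (α : ℝ) (m : ℕ) (t : ℝ) : RKHA p τ →L[ℂ] RKHA p τ :=
  NormedSpace.exp ((t : ℂ) • WFin p τ α m)

/-- The Nyström operator: the representative in `H_τ` of a class in the range of `K_τ^*` (which is
injective). -/
def nystrom (p : Exponent) (τ : PosReal) (u : Lp ℂ 2 haar) : RKHA p τ :=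
  Function.invFun (restrictOp p τ) u

/-- The Dirichlet energy of a nonzero class in the range of `K_τ^*`. -/
def dirichletEnergy (p : Exponent) (τ : PosReal) (u : Lp ℂ 2 haar) : ℝ :=
  ‖nystrom p τ u‖ ^ 2 / ‖u‖ ^ 2 - 1

/-- The vector `u = ∑_{i<m} c_i e^{i (freq i) ·}` of `L²(𝕋)` that belongs to
`g = ∑_{i<m} c_i ψ_{freq i}`. It takes eigenvectors of `W_{τ,m}` in `H_{τ,m}` to eigenvectors of the
corresponding compression of `V_τ`. -/
def toL2Vec (m : ℕ) (g : RKHA p τ) : Lp ℂ 2 haar :=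
  ∑ i ∈ Finset.range m, ⟪psi p τ (freq i), g⟫_ℂ • fourierLp 2 (freq i)

/-- `ζ_0, …, ζ_{m-1}` is an orthonormal basis of `H_{τ,m}` of eigenvectors of `W_{τ,m}`, in order of
increasing Dirichlet energy. -/
structure IsEigenbasis (p : Exponent) (τ : PosReal) (α : ℝ) (m : ℕ) (ζ : Fin m → RKHA p τ) :
    Prop where
  orthonormal : Orthonormal ℂ ζ
  mem : ∀ j, ζ j ∈ Submodule.span ℂ {g | ∃ i < m, g = psi p τ (freq i)}
  eigen : ∀ j, ∃ ω : ℝ, WFin p τ α m (ζ j) = (Complex.I * ω) • ζ j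
  ordered : Monotone fun j => dirichletEnergy p τ (toL2Vec m (ζ j))

/-- The orthogonal projection `Z = ∑_{j ≤ 2d} ⟨ζ_j, ·⟩ ζ_j` onto `span {ζ_0, …, ζ_{2d}}`. -/
def ZProj (d m : ℕ) (ζ : Fin m → RKHA p τ) : RKHA p τ →L[ℂ] RKHA p τ :=
  ∑ j ∈ Finset.univ.filter (fun j : Fin m => (j : ℕ) ≤ 2 * d), rankOne ℂ (ζ j) (ζ j)

/-! ### The Fock space -/

/-- The Fock space `F(H_τ) = ℂ ⊕ H_τ ⊕ H_τ^{⊗2} ⊕ …` (Hilbert space completion), stored through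
coordinates in the orthonormal basis `ψ_{j_1} ⊗ ⋯ ⊗ ψ_{j_n}` indexed by words `[j_1, …, j_n]`.
The elementary tensors are `pureTensor` below; their inner products are computed in
`inner_pureTensor_nil`, `inner_pureTensor_cons`, `inner_pureTensor_of_length_ne`, and their span is
dense by `dense_span_pureTensor`. -/

def Fock (_p : Exponent) (_τ : PosReal) : Type := lp (fun _ : List ℤ => ℂ) 2

instance : NormedAddCommGroup (Fock p τ) :=
  inferInstanceAs (NormedAddCommGroup (lp (fun _ : List ℤ => ℂ) 2))
instance : InnerProductSpace ℂ (Fock p τ) :=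
  inferInstanceAs (InnerProductSpace ℂ (lp (fun _ : List ℤ => ℂ) 2))
instance : CompleteSpace (Fock p τ) :=
  inferInstanceAs (CompleteSpace (lp (fun _ : List ℤ => ℂ) 2))

/-- The coordinate along `ψ_{j_1} ⊗ ⋯ ⊗ ψ_{j_n}`. -/
def Fock.coord (F : Fock p τ) (a : List ℤ) : ℂ := (show lp (fun _ : List ℤ => ℂ) 2 from F) a

/-- The coordinates of `g_1 ⊗ ⋯ ⊗ g_n`. -/
def pureCoord : List (RKHA p τ) → List ℤ → ℂ
  | [], [] => 1
  | g :: l, j :: a => g.coord j * pureCoord l a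
  | _, _ => 0


theorem summable_pureCoord (l : List (RKHA p τ)) :
    Summable fun a : List ℤ => ‖pureCoord l a‖ ^ 2 := by
  induction l with
  | nil =>
    refine summable_of_ne_finset_zero (s := {[]}) fun a ha => ?_
    cases a with
    | nil => simp at ha
    | cons j a => simp [pureCoord]
  | cons g l ih =>
    have hinj : Function.Injective (fun q : ℤ × List ℤ => q.1 :: q.2) := fun q r h => by
      simpa [Prod.ext_iff] using h
    refine (hinj.summable_iff ?_).1 ?_
    · intro a ha
      cases a with
      | nil => simp [pureCoord]
      | cons j a => exact absurd ⟨(j, a), rfl⟩ ha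
    · refine (g.norm_sq_hasSum.summable.mul_of_nonneg ih (fun _ => by positivity)
        (fun _ => by positivity)).congr fun q => ?_
      simp [pureCoord, mul_pow]

/-- The elementary tensor `g_1 ⊗ ⋯ ⊗ g_n`; the empty list gives the vacuum vector. -/
def pureTensor (l : List (RKHA p τ)) : Fock p τ :=
  (show Fock p τ from (⟨pureCoord l, memℓp_gen (by simpa using summable_pureCoord l)⟩ :
    lp (fun _ : List ℤ => ℂ) 2))

theorem coord_pureTensor (l : List (RKHA p τ)) (a : List ℤ) :
    (pureTensor l).coord a = pureCoord l a := rfl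

theorem inner_fock (F G : Fock p τ) :
    HasSum (fun a => ⟪F.coord a, G.coord a⟫_ℂ) ⟪F, G⟫_ℂ :=
  lp.hasSum_inner (𝕜 := ℂ) (show lp (fun _ : List ℤ => ℂ) 2 from F)
    (show lp (fun _ : List ℤ => ℂ) 2 from G)

theorem inner_rkha (g h : RKHA p τ) :
    HasSum (fun j => ⟪g.coord j, h.coord j⟫_ℂ) ⟪g, h⟫_ℂ :=
  lp.hasSum_inner (𝕜 := ℂ) (show lp (fun _ : ℤ => ℂ) 2 from g)
    (show lp (fun _ : ℤ => ℂ) 2 from h)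

theorem inner_pureTensor_nil : ⟪pureTensor ([] : List (RKHA p τ)), pureTensor []⟫_ℂ = 1 := by
  refine (inner_fock _ _).unique ?_
  have h := hasSum_single (f := fun a : List ℤ => ⟪pureCoord ([] : List (RKHA p τ)) a,
    pureCoord ([] : List (RKHA p τ)) a⟫_ℂ) [] (fun a ha => by
      cases a with
      | nil => exact absurd rfl ha
      | cons j a => simp [pureCoord])
  have e : ⟪pureCoord ([] : List (RKHA p τ)) [], pureCoord ([] : List (RKHA p τ)) []⟫_ℂ = 1 := by
    simp [pureCoord]
  rw [e] at h
  exact h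

theorem inner_pureTensor_cons (g h : RKHA p τ) (l k : List (RKHA p τ)) :
    ⟪pureTensor (g :: l), pureTensor (h :: k)⟫_ℂ = ⟪g, h⟫_ℂ * ⟪pureTensor l, pureTensor k⟫_ℂ := by
  have hinj : Function.Injective (fun q : ℤ × List ℤ => q.1 :: q.2) := fun q r h => by
    simpa [Prod.ext_iff] using h
  have h0 : ∀ a ∉ Set.range (fun q : ℤ × List ℤ => q.1 :: q.2),
      ⟪(pureTensor (g :: l)).coord a, (pureTensor (h :: k)).coord a⟫_ℂ = 0 := by
    intro a ha
    cases a with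
    | nil => simp [coord_pureTensor, pureCoord]
    | cons j a => exact absurd ⟨(j, a), rfl⟩ ha
  have h1 := (hinj.hasSum_iff h0).2 (inner_fock (pureTensor (g :: l)) (pureTensor (h :: k)))
  have h2 : (fun a => ⟪(pureTensor (g :: l)).coord a, (pureTensor (h :: k)).coord a⟫_ℂ) ∘
      (fun q : ℤ × List ℤ => q.1 :: q.2) = fun q : ℤ × List ℤ => ⟪g.coord q.1, h.coord q.1⟫_ℂ *
        ⟪(pureTensor l).coord q.2, (pureTensor k).coord q.2⟫_ℂ := by
    funext q
    simp only [Function.comp, coord_pureTensor, pureCoord, RCLike.inner_apply, map_mul]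
    ring
  rw [h2] at h1
  have h3 : HasSum (fun q : ℤ × List ℤ => ⟪g.coord q.1, h.coord q.1⟫_ℂ *
        ⟪(pureTensor l).coord q.2, (pureTensor k).coord q.2⟫_ℂ)
        (⟪g, h⟫_ℂ * ⟪pureTensor l, pureTensor k⟫_ℂ) :=
    HasSum.mul (f := fun j => ⟪g.coord j, h.coord j⟫_ℂ)
      (g := fun a => ⟪(pureTensor l).coord a, (pureTensor k).coord a⟫_ℂ)
      (inner_rkha g h) (inner_fock (pureTensor l) (pureTensor k)) h1.summable
  exact h1.unique h3

theorem inner_pureTensor_of_length_ne (l k : List (RKHA p τ)) (h : l.length ≠ k.length) :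
    ⟪pureTensor l, pureTensor k⟫_ℂ = 0 := by
  have key : ∀ (l : List (RKHA p τ)) (a : List ℤ), a.length ≠ l.length → pureCoord l a = 0 := by
    intro l
    induction l with
    | nil => intro a ha; cases a with
      | nil => simp at ha
      | cons j a => simp [pureCoord]
    | cons g l ih => intro a ha; cases a with
      | nil => simp [pureCoord]
      | cons j a => simp [pureCoord, ih a (by simpa using ha)]
  refine (inner_fock _ _).unique ?_
  convert hasSum_zero using 1
  funext a
  by_cases ha : a.length = l.length
  · rw [coord_pureTensor k, key k a (by omega), inner_zero_right]
  · rw [coord_pureTensor l, key l a ha, inner_zero_left]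

theorem pureCoord_psi (a b : List ℤ) :
    pureCoord (a.map (psi p τ)) b = if b = a then 1 else 0 := by
  induction a generalizing b with
  | nil => cases b <;> simp [pureCoord]
  | cons j a ih =>
    cases b with
    | nil => simp [pureCoord]
    | cons k b =>
      simp only [List.map_cons, pureCoord, coord_psi, ih, List.cons.injEq]
      by_cases h1 : k = j <;> by_cases h2 : b = a <;> simp [h1, h2]

theorem inner_pureTensor_psi (a : List ℤ) (F : Fock p τ) :
    ⟪pureTensor (a.map (psi p τ)), F⟫_ℂ = F.coord a := by
  have h1 := inner_fock (pureTensor (a.map (psi p τ))) F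
  have h2 := hasSum_single (f := fun b => ⟪(pureTensor (a.map (psi p τ))).coord b, F.coord b⟫_ℂ) a
    (fun b hb => by simp [coord_pureTensor, pureCoord_psi, hb])
  rw [h1.unique h2]
  simp [coord_pureTensor, pureCoord_psi]

theorem dense_span_pureTensor :
    (Submodule.span ℂ (Set.range (pureTensor (p := p) (τ := τ)))).topologicalClosure = ⊤ := by
  rw [Submodule.topologicalClosure_eq_top_iff, Submodule.eq_bot_iff]
  intro F hF
  refine lp.ext (funext fun a => ?_)
  change F.coord a = 0
  rw [← inner_pureTensor_psi]
  exact (Submodule.mem_orthogonal _ _).1 hF _ (Submodule.subset_span ⟨_, rfl⟩)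

/-- The bounded linear operator with `u i ↦ v i` for all `i`. It is unique if the `u i` span a dense
subspace; the value is `0` if there is none. -/
def boundedExtension {ι E F : Type} [NormedAddCommGroup E] [NormedSpace ℂ E]
    [NormedAddCommGroup F] [NormedSpace ℂ F] (u : ι → E) (v : ι → F) : E →L[ℂ] F :=
  open Classical in
  if h : ∃ T : E →L[ℂ] F, ∀ i, T (u i) = v i then h.choose else 0

/-- The `n`-fold comultiplication `Δ_{n-1} : H_τ → H_τ^{⊗n} ⊆ F(H_τ)`, that is, the bounded linear
extension of `k_x ↦ k_x ⊗ ⋯ ⊗ k_x` (`n` factors). -/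
def comul (p : Exponent) (τ : PosReal) (n : ℕ) : RKHA p τ →L[ℂ] Fock p τ :=
  boundedExtension (kernelSection p τ)
    (fun x => pureTensor (List.replicate n (kernelSection p τ x)))

/-- The lift of an operator `U` on `H_τ` to the Fock space: the bounded linear operator with
`g_1 ⊗ ⋯ ⊗ g_n ↦ U g_1 ⊗ ⋯ ⊗ U g_n` (and fixing the vacuum). -/
def fockLift (U : RKHA p τ →L[ℂ] RKHA p τ) : Fock p τ →L[ℂ] Fock p τ :=
  boundedExtension (pureTensor (p := p) (τ := τ)) (fun l => pureTensor (l.map U))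

/-- The trace of a (trace class) operator on the Fock space, in the orthonormal basis
`ψ_{j_1} ⊗ ⋯ ⊗ ψ_{j_n}`. -/
def fockTrace (T : Fock p τ →L[ℂ] Fock p τ) : ℂ :=
  ∑' a : List ℤ, ⟪pureTensor (a.map (psi p τ)), T (pureTensor (a.map (psi p τ)))⟫_ℂ

/-- The expectation `𝔼_ρ A = tr (ρ A)`. -/
def fockExpectation (ρ A : Fock p τ →L[ℂ] Fock p τ) : ℂ := fockTrace (ρ ∘L A)

/-- The evolution `ρ ↦ Ũ^{t*} ρ Ũ^t` of states on the Fock space, for `Ũ^t` the lift of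
`U^t_{τ,m}`. -/
def fockEvolve (α : ℝ) (m : ℕ) (t : ℝ) (ρ : Fock p τ →L[ℂ] Fock p τ) : Fock p τ →L[ℂ] Fock p τ :=
  ContinuousLinearMap.adjoint (fockLift (UFin p τ α m t)) ∘L ρ ∘L fockLift (UFin p τ α m t)

/-! ### Observables -/

/-- The multiplication operator `u ↦ f u` on `L²(𝕋)` for `f ∈ L^∞(𝕋)`. -/
def multOp (f : Lp ℂ ∞ haar) : Lp ℂ 2 haar →L[ℂ] Lp ℂ 2 haar :=
  (ContinuousLinearMap.mul ℂ ℂ).holderL haar ∞ 2 2 f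

/-- The quantum observable `A_{f,τ,n} = Δ_{n-1} (K_τ f K_τ^*) Δ_{n-1}^*` on the Fock space. -/
def fockObservable (p : Exponent) (τ : PosReal) (n : ℕ) (f : Lp ℂ ∞ haar) :
    Fock p τ →L[ℂ] Fock p τ :=
  comul p τ n ∘L (kernelOp p τ ∘L multOp f ∘L restrictOp p τ) ∘L ContinuousLinearMap.adjoint (comul p τ n)

/-! ### Von Mises feature maps -/

/-- The modified Bessel function of the first kind of order `j`. -/
def besselI (j : ℕ) (x : ℝ) : ℝ :=
  (x / 2) ^ j * ∑' r : ℕ, (x / 2) ^ (2 * r) / ((r.factorial : ℝ) * ((r + j).factorial : ℝ))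

/-- The von Mises density `σ_{μ,κ}`, with respect to the Haar probability measure. -/
def vonMises (μ : Circ) (κ : ℝ) (θ : Circ) : ℝ :=
  Real.exp (κ * Real.Angle.cos (θ - μ)) / besselI 0 κ

/-- The element of `H_τ` that represents a given function on the circle (there is at most one; the
value is of no significance if there is none). -/
def ofFun (p : Exponent) (τ : PosReal) (g : Circ → ℂ) : RKHA p τ :=
  Function.invFun (fun h : RKHA p τ => (h : Circ → ℂ)) g

/-- The feature map `F_{κ,τ}(x) = σ_{x,κ} / ‖σ_{x,κ}‖`. -/
def feature (p : Exponent) (τ : PosReal) (κ : ℝ) (x : Circ) : RKHA p τ :=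
  ((‖ofFun p τ (fun θ => (vonMises x κ θ : ℂ))‖⁻¹ : ℝ) : ℂ) •
    ofFun p τ (fun θ => (vonMises x κ θ : ℂ))

/-- The `n`-th root `ξ^{1/n} ∈ H_τ` of a strictly positive `ξ ∈ H_τ`. -/
def rkhaRoot (n : ℕ) (ξ : RKHA p τ) : RKHA p τ :=
  ofFun p τ (fun θ => (ξ θ) ^ (1 / (n : ℂ)))

/-- The projected and normalized root `Z ξ^{1/n} / ‖Z ξ^{1/n}‖`. -/
def projRoot (d m : ℕ) (ζ : Fin m → RKHA p τ) (ξ : RKHA p τ) (n : ℕ) : RKHA p τ :=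
  ((‖ZProj d m ζ (rkhaRoot n ξ)‖⁻¹ : ℝ) : ℂ) • ZProj d m ζ (rkhaRoot n ξ)

/-- The Fock space valued feature map: `∑_{n ≥ 1} w_n ξ_n^{⊗n}`, where `ξ_n` is the projected and
normalized `n`-th root of `ξ = F_{κ,τ}(x)`. -/
def fockFeature (w : ℕ+ → ℝ) (κ : ℝ) (d m : ℕ) (ζ : Fin m → RKHA p τ) (x : Circ) : Fock p τ :=
  ∑' n : ℕ+, (w n : ℂ) •
    pureTensor (List.replicate (n : ℕ) (projRoot d m ζ (feature p τ κ x) n))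

/-- The quantum feature map: the rank-one operator `⟨η, ·⟩ η` for `η` the value of `fockFeature`. -/
def quantumFeature (w : ℕ+ → ℝ) (κ : ℝ) (d m : ℕ) (ζ : Fin m → RKHA p τ) (x : Circ) :
    Fock p τ →L[ℂ] Fock p τ :=
  rankOne ℂ (fockFeature w κ d m ζ x) (fockFeature w κ d m ζ x)

/-- The Fock space (tensor network) prediction: the expectation of `A_{f,τ,n}` in the evolved state,
normalized by the expectation of `A_{1,τ,n}`. -/
def fockPrediction (α t : ℝ) (w : ℕ+ → ℝ) (κ : ℝ) (n d m : ℕ) (ζ : Fin m → RKHA p τ)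
    (f : Lp ℂ ∞ haar) (x : Circ) : ℂ :=
  fockExpectation (fockEvolve α m t (quantumFeature w κ d m ζ x)) (fockObservable p τ n f) /
    fockExpectation (fockEvolve α m t (quantumFeature w κ d m ζ x))
      (fockObservable p τ n (Lp.const ∞ haar 1))

/-- The expectation `𝔼_ϱ g = ∫ g ϱ` of `g ∈ L^∞(𝕋)` with respect to a probability density `ϱ`. -/
def classicalExpectation (ϱ : Circ → ℝ) (g : Lp ℂ ∞ haar) : ℂ :=
  ∫ θ, g θ * (ϱ θ : ℂ) ∂haar

end FockKoopman

end

open FockKoopman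

/-!
The prediction is a ratio of averages over the circle. The adjoint of the comultiplication `Δ_{n-1}`
multiplies tensor factors pointwise, so it sees only the grade `n` of the Fock space vector `η` and
turns `ξ_n ⊗ ⋯ ⊗ ξ_n`, evolved by the adjoint of the lift of `U^t_{τ,m}`, into the `n`-th power of a
function `P` on the circle. Hence the prediction is `∫ f |P|^{2n} / ∫ |P|^{2n}`, where all positive
scalars, the weight `w_n` included, cancel (`fockPrediction_eq`). This uses that `Δ_{n-1}` is
bounded (`comul_kernelSection`), which holds because the weights satisfy `λ * λ ≤ C λ`
(`tsum_weight_mul_weight_le`): by concavity, `|j|^p + |l|^p - |j + l|^p` is at least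
`(1 - p) min (|j|, |l|)^p`.

The operator `W_{τ,m}` is diagonal in the basis `ψ_j`, with eigenvalues `i α j λ_τ(j)`
(`coord_WFin`). For `m` fixed and `τ` small these are distinct, so the vectors of an eigenbasis are
the `ψ_j` up to phases, and the order by Dirichlet energy makes `Z_{τ,d,m}` the truncation of the
Fourier series to `|j| ≤ d` (`IsEigenbasis.ZProj_eq`). The `n`-th root of the von Mises density is a
multiple of `e^{s cos(x - θ)}` with `s = κ / n`, so `P` is, up to a factor, the truncation of this
function with the Fourier coefficient at `j` multiplied by `e^{-i α j λ_τ(j) t}` (`evolvedTrunc`).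

As `e^{s cos} = 1 + s cos + O(s ^ 2)`, truncation costs `O(s ^ 2)` for `d ≥ 1`. Replacing the phases
by `e^{-i α j t}` costs `o(s)`: the coefficients with `j ≠ 0` are `O(s)`, and the phase at `j = 0`
is exact. Together `P(x) = e^{s cos(x - αt - θ)} + o(1 / n)` uniformly in `x`, whence
`P ^ n → e^{κ cos(x - αt - θ)}` uniformly (`norm_evolvedTrunc_pow_sub_le`). Thus `|P|^{2n}` tends to
`e^{2κ cos(x - αt - θ)}`, a multiple of the von Mises density with concentration `2κ` transported by
the flow. Only `n → ∞` and `τ → 0` matter, so any constants `c₁` and `c₂` will do.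
-/

noncomputable section

namespace FockKoopman

variable {p : Exponent} {τ : PosReal}

/-! ### Subconvolutivity of the weights -/

theorem weight_zero (p : Exponent) (τ : PosReal) : weight p τ 0 = 1 := by
  simp [weight, Real.zero_rpow p.2.1.ne']

/-- A strengthening of subadditivity of `x ↦ x ^ q`, from Bernoulli's inequality. -/
theorem add_rpow_le_of_le {q a b : ℝ} (hq0 : 0 < q) (hq1 : q < 1) (ha : 0 ≤ a) (hab : a ≤ b) :
    (a + b) ^ q ≤ b ^ q + q * a ^ q := by
  rcases ha.eq_or_lt with rfl | ha
  · simp [Real.zero_rpow hq0.ne']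
  have hb : 0 < b := ha.trans_le hab
  have hx0 : 0 < a / b := div_pos ha hb
  have hx1 : a / b ≤ 1 := (div_le_one hb).2 hab
  have h1 : (1 + a / b) ^ q ≤ 1 + q * (a / b) :=
    rpow_one_add_le_one_add_mul_self (by linarith) hq0.le hq1.le
  have h2 : a / b ≤ (a / b) ^ q := by
    simpa using Real.rpow_le_rpow_of_exponent_ge hx0 hx1 hq1.le
  have h3 : a + b = b * (1 + a / b) := by field_simp; ring
  rw [h3, Real.mul_rpow hb.le (by positivity)]
  calc b ^ q * (1 + a / b) ^ q ≤ b ^ q * (1 + q * (a / b) ^ q) := by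
        gcongr
        exact h1.trans (by gcongr)
    _ = b ^ q + q * a ^ q := by
        rw [Real.div_rpow ha.le hb.le]
        field_simp

/-- The rate `(1 - p) τ`, at which `λ_τ(j) λ_τ(k - j) / λ_τ(k)` decays in `min (|j|, |k - j|)`. -/
def slowRate (p : Exponent) (τ : PosReal) : PosReal :=
  ⟨(1 - p) * τ, mul_pos (sub_pos.2 p.2.2) τ.2⟩

theorem weight_mul_weight_le_of_le {j l : ℤ} (h : |j| ≤ |l|) :
    weight p τ j * weight p τ l ≤ weight p τ (j + l) * weight p (slowRate p τ) j := by
  simp only [weight, slowRate, ← Real.exp_add]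
  apply Real.exp_le_exp.2
  have h1 : |((j + l : ℤ) : ℝ)| ^ (p : ℝ) ≤ |(l : ℝ)| ^ (p : ℝ) + p * |(j : ℝ)| ^ (p : ℝ) := by
    refine le_trans ?_ (add_rpow_le_of_le p.2.1 p.2.2 (abs_nonneg (j : ℝ)) (by exact_mod_cast h))
    push_cast
    exact Real.rpow_le_rpow (abs_nonneg _) (abs_add_le _ _) p.2.1.le
  have := mul_le_mul_of_nonneg_left h1 τ.2.le
  linarith

theorem weight_mul_weight_le (j l : ℤ) :
    weight p τ j * weight p τ l ≤
      weight p τ (j + l) * (weight p (slowRate p τ) j + weight p (slowRate p τ) l) := by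
  have hj := weight_pos p (slowRate p τ) j
  have hl := weight_pos p (slowRate p τ) l
  have hs := weight_pos p τ (j + l)
  have hs' := weight_pos p τ (l + j)
  rcases le_total |j| |l| with h | h
  · exact (weight_mul_weight_le_of_le h).trans (by gcongr; linarith)
  · rw [mul_comm (weight p τ j), add_comm j l]
    exact (weight_mul_weight_le_of_le h).trans (by gcongr; linarith)

/-- The constant of the inequality `λ * λ ≤ C λ` for the weights. -/
def convConst (p : Exponent) (τ : PosReal) : ℝ≥0∞ :=
  2 * ∑' j, ENNReal.ofReal (weight p (slowRate p τ) j)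

theorem convConst_ne_top (p : Exponent) (τ : PosReal) : convConst p τ ≠ ∞ :=
  ENNReal.mul_ne_top (by simp) (summable_weight p _).tsum_ofReal_ne_top

/-- The weights are subconvolutive. -/
theorem tsum_weight_mul_weight_le (k : ℤ) :
    ∑' j, ENNReal.ofReal (weight p τ j) * ENNReal.ofReal (weight p τ (k - j)) ≤
      convConst p τ * ENNReal.ofReal (weight p τ k) := by
  calc ∑' j, ENNReal.ofReal (weight p τ j) * ENNReal.ofReal (weight p τ (k - j))
      ≤ ∑' j, ENNReal.ofReal (weight p τ k) * (ENNReal.ofReal (weight p (slowRate p τ) j) +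
          ENNReal.ofReal (weight p (slowRate p τ) (k - j))) := by
        refine ENNReal.tsum_le_tsum fun j => ?_
        rw [← ENNReal.ofReal_mul (weight_pos _ _ _).le,
          ← ENNReal.ofReal_add (weight_pos _ _ _).le (weight_pos _ _ _).le,
          ← ENNReal.ofReal_mul (weight_pos _ _ _).le]
        refine ENNReal.ofReal_le_ofReal ((weight_mul_weight_le j (k - j)).trans_eq ?_)
        rw [add_sub_cancel]
    _ = convConst p τ * ENNReal.ofReal (weight p τ k) := by
        rw [ENNReal.tsum_mul_left, ENNReal.tsum_add,
          show ∑' j, ENNReal.ofReal (weight p (slowRate p τ) (k - j)) =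
              ∑' j, ENNReal.ofReal (weight p (slowRate p τ) j) from
            (Equiv.subLeft k).tsum_eq fun j => ENNReal.ofReal (weight p (slowRate p τ) j),
          convConst]
        ring

/-- The weight `λ_τ(j_1) ⋯ λ_τ(j_n)` of a word. -/
def wordWeight (p : Exponent) (τ : PosReal) (a : List ℤ) : ℝ := (a.map (weight p τ)).prod

theorem wordWeight_pos (a : List ℤ) : 0 < wordWeight p τ a :=
  List.prod_pos fun x hx => by
    obtain ⟨j, -, rfl⟩ := List.mem_map.1 hx
    exact weight_pos p τ j

theorem tsum_list_eq (F : List ℤ → ℝ≥0∞) :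
    ∑' a, F a = F [] + ∑' j, ∑' a, F (j :: a) := by
  have hinj : Function.Injective (fun q : ℤ × List ℤ => q.1 :: q.2) := fun q r h => by
    simpa [Prod.ext_iff] using h
  have hsupp : Function.support (fun a : List ℤ => if a = [] then 0 else F a) ⊆
      Set.range (fun q : ℤ × List ℤ => q.1 :: q.2) := by
    intro a ha
    cases a with
    | nil => simp at ha
    | cons j a => exact ⟨(j, a), rfl⟩
  rw [ENNReal.tsum_eq_add_tsum_ite []]
  congr 1
  refine Eq.trans (tsum_congr fun a => by congr) ((hinj.tsum_eq hsupp).symm.trans ?_)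
  rw [← ENNReal.tsum_prod]
  simp

/-- The words of length `n` with a given sum have total weight at most `C ^ n` times the weight of
that sum; this is tested against an arbitrary function `h` of the sum. -/
theorem tsum_word_le (n : ℕ) (h : ℤ → ℝ≥0∞) :
    ∑' a : List ℤ, (if a.length = n then h a.sum * ENNReal.ofReal (wordWeight p τ a) else 0) ≤
      convConst p τ ^ n * ∑' k, h k * ENNReal.ofReal (weight p τ k) := by
  induction n generalizing h with
  | zero =>
    rw [tsum_eq_single []]
    · have := ENNReal.le_tsum (f := fun k => h k * ENNReal.ofReal (weight p τ k)) 0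
      simpa [wordWeight, weight_zero] using this
    · intro a ha
      simp [ha]
  | succ n ih =>
    rw [tsum_list_eq]
    simp only [List.length_nil, (Nat.succ_ne_zero n).symm, if_false, zero_add, List.length_cons,
      Nat.add_right_cancel_iff, List.sum_cons]
    calc _ = ∑' j, ENNReal.ofReal (weight p τ j) * ∑' a : List ℤ, (if a.length = n then
              h (j + a.sum) * ENNReal.ofReal (wordWeight p τ a) else 0) := by
          refine tsum_congr fun j => ?_
          rw [← ENNReal.tsum_mul_left]
          refine tsum_congr fun a => ?_
          split_ifs
          · have : wordWeight p τ (j :: a) = weight p τ j * wordWeight p τ a := by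
              simp [wordWeight]
            rw [this, ENNReal.ofReal_mul (weight_pos _ _ _).le]
            ring
          · simp
      _ ≤ ∑' j, ENNReal.ofReal (weight p τ j) *
            (convConst p τ ^ n * ∑' k, h (j + k) * ENNReal.ofReal (weight p τ k)) := by
          gcongr with j
          exact ih fun k => h (j + k)
      _ = convConst p τ ^ n * ∑' k, h k *
            ∑' j, ENNReal.ofReal (weight p τ j) * ENNReal.ofReal (weight p τ (k - j)) := by
          have hshift : ∀ j, ∑' k, h (j + k) * ENNReal.ofReal (weight p τ k) =
              ∑' k, h k * ENNReal.ofReal (weight p τ (k - j)) := fun j => by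
            rw [← (Equiv.addLeft j).tsum_eq fun k => h k * ENNReal.ofReal (weight p τ (k - j))]
            simp
          simp_rw [hshift, mul_left_comm _ (convConst p τ ^ n), ENNReal.tsum_mul_left,
            ← ENNReal.tsum_mul_left (a := ENNReal.ofReal _), ← ENNReal.tsum_mul_left (a := h _)]
          rw [ENNReal.tsum_comm]
          simp_rw [mul_left_comm (h _)]
      _ ≤ convConst p τ ^ n * ∑' k, h k * (convConst p τ * ENNReal.ofReal (weight p τ k)) := by
          gcongr with k
          exact tsum_weight_mul_weight_le k
      _ = _ := by
          rw [pow_succ, mul_assoc, ← ENNReal.tsum_mul_left (a := convConst p τ)]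
          congr 1
          refine tsum_congr fun k => ?_
          ring

/-! ### The comultiplication -/

theorem RKHA.ext_coord {g h : RKHA p τ} (H : ∀ j, g.coord j = h.coord j) : g = h :=
  lp.ext (funext H)

theorem Fock.ext_coord {F G : Fock p τ} (H : ∀ a, F.coord a = G.coord a) : F = G :=
  lp.ext (funext H)

theorem Fock.norm_sq_hasSum (F : Fock p τ) : HasSum (fun a => ‖F.coord a‖ ^ 2) (‖F‖ ^ 2) := by
  convert Complex.hasSum_re (inner_fock F F) using 1
  · funext a
    exact (inner_self_eq_norm_sq (𝕜 := ℂ) (F.coord a)).symm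
  · exact (inner_self_eq_norm_sq (𝕜 := ℂ) F).symm

/-- The vector of the Fock space with given square-summable coordinates. -/
def Fock.mk (c : List ℤ → ℂ) (hc : Summable fun a => ‖c a‖ ^ 2) : Fock p τ :=
  (show Fock p τ from (⟨c, memℓp_gen (by simpa using hc)⟩ : lp (fun _ : List ℤ => ℂ) 2))

theorem Fock.coord_mk (c : List ℤ → ℂ) (hc : Summable fun a => ‖c a‖ ^ 2) (a : List ℤ) :
    (Fock.mk (p := p) (τ := τ) c hc).coord a = c a := rfl

theorem Fock.coord_add (F G : Fock p τ) (a : List ℤ) :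
    (F + G).coord a = F.coord a + G.coord a := rfl

theorem Fock.coord_smul (c : ℂ) (F : Fock p τ) (a : List ℤ) :
    (c • F).coord a = c * F.coord a := rfl

/-- The bounded operator into the Fock space whose coordinates are given by a linear map `c` with
the `ℓ²` bound `C`. -/
def Fock.ofCoordMap {E : Type*} [NormedAddCommGroup E] [NormedSpace ℂ E]
    (c : E →ₗ[ℂ] List ℤ → ℂ) (C : ℝ)
    (hc : ∀ g, ∃ s ≤ C ^ 2 * ‖g‖ ^ 2, HasSum (fun a => ‖c g a‖ ^ 2) s) (hC : 0 ≤ C) :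
    E →L[ℂ] Fock p τ :=
  LinearMap.mkContinuous
    { toFun := fun g => Fock.mk (c g) (hc g).choose_spec.2.summable
      map_add' := fun g h => Fock.ext_coord fun a => by
        rw [Fock.coord_add]
        simp only [Fock.coord_mk, map_add, Pi.add_apply]
      map_smul' := fun z g => Fock.ext_coord fun a => by
        rw [Fock.coord_smul]
        simp only [Fock.coord_mk, map_smul, Pi.smul_apply, smul_eq_mul, RingHom.id_apply] }
    C
    (fun g => by
      obtain ⟨s, hs, h⟩ := hc g
      have h1 := (Fock.norm_sq_hasSum
        (Fock.mk (p := p) (τ := τ) (c g) (hc g).choose_spec.2.summable)).unique h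
      exact (sq_le_sq₀ (norm_nonneg _) (by positivity)).1 (by rw [mul_pow]; exact h1.trans_le hs))

/-- The coordinates of `Δ_{n-1} g`. The factor of `g.coord j` at a word with sum `j` is dual to the
pointwise product: `ψ_{j_1} ⋯ ψ_{j_n}` is this factor times `ψ_{j_1 + ⋯ + j_n}`. -/
def comulCoord (p : Exponent) (τ : PosReal) (n : ℕ) : RKHA p τ →ₗ[ℂ] List ℤ → ℂ where
  toFun g a := if a.length = n then
    g.coord a.sum * (√(wordWeight p τ a / weight p τ a.sum) : ℂ) else 0
  map_add' g h := by
    funext a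
    simp only [Pi.add_apply, RKHA.coord_add]
    split_ifs <;> ring
  map_smul' c g := by
    funext a
    simp only [Pi.smul_apply, RKHA.coord_smul, smul_eq_mul, RingHom.id_apply]
    split_ifs <;> ring

theorem comulCoord_bound (n : ℕ) (g : RKHA p τ) :
    ∃ s ≤ (√(convConst p τ ^ n).toReal) ^ 2 * ‖g‖ ^ 2,
      HasSum (fun a => ‖comulCoord p τ n g a‖ ^ 2) s := by
  have hlt : convConst p τ ^ n ≠ ∞ := ENNReal.pow_ne_top (convConst_ne_top p τ)
  have h0 := tsum_word_le (p := p) (τ := τ) n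
    fun k => ENNReal.ofReal (‖g.coord k‖ ^ 2 / weight p τ k)
  have h1 : ∑' k, ENNReal.ofReal (‖g.coord k‖ ^ 2 / weight p τ k) *
      ENNReal.ofReal (weight p τ k) = ENNReal.ofReal (‖g‖ ^ 2) := by
    rw [← g.norm_sq_hasSum.tsum_eq,
      ENNReal.ofReal_tsum_of_nonneg (fun _ => by positivity) g.norm_sq_hasSum.summable]
    refine tsum_congr fun k => ?_
    have := weight_pos p τ k
    rw [← ENNReal.ofReal_mul (by positivity), div_mul_cancel₀ _ this.ne']
  have h2 : ∀ a : List ℤ, (if a.length = n then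
      ENNReal.ofReal (‖g.coord a.sum‖ ^ 2 / weight p τ a.sum) *
        ENNReal.ofReal (wordWeight p τ a) else 0) =
      ENNReal.ofReal (‖comulCoord p τ n g a‖ ^ 2) := by
    intro a
    have := weight_pos p τ a.sum
    have := wordWeight_pos (p := p) (τ := τ) a
    simp only [comulCoord, LinearMap.coe_mk, AddHom.coe_mk]
    split_ifs
    · rw [← ENNReal.ofReal_mul (by positivity), norm_mul, mul_pow, Complex.norm_real,
        Real.norm_of_nonneg (Real.sqrt_nonneg _), Real.sq_sqrt (by positivity)]
      congr 1
      ring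
    · simp
  rw [h1] at h0
  simp_rw [h2] at h0
  have hfin : ∑' a, ENNReal.ofReal (‖comulCoord p τ n g a‖ ^ 2) ≠ ∞ :=
    ne_top_of_le_ne_top (ENNReal.mul_ne_top hlt ENNReal.ofReal_ne_top) h0
  have hs : Summable fun a => ‖comulCoord p τ n g a‖ ^ 2 := by
    refine (ENNReal.summable_toReal hfin).congr fun a => ENNReal.toReal_ofReal (by positivity)
  refine ⟨_, ?_, hs.hasSum⟩
  rw [← ENNReal.ofReal_tsum_of_nonneg (fun _ => by positivity) hs,
    ← ENNReal.ofReal_toReal hlt, ← ENNReal.ofReal_mul ENNReal.toReal_nonneg] at h0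
  rw [Real.sq_sqrt ENNReal.toReal_nonneg]
  exact (ENNReal.ofReal_le_ofReal_iff (by positivity)).1 h0

theorem coord_kernelSection (x : Circ) (j : ℤ) :
    (kernelSection p τ x).coord j = (√(weight p τ j) : ℂ) * fourier (-j) x := by
  rw [← inner_psi, kernelSection, RKHS.inner_kerFun, psi_apply]
  simp

theorem boundedExtension_apply {ι E F : Type} [NormedAddCommGroup E] [NormedSpace ℂ E]
    [NormedAddCommGroup F] [NormedSpace ℂ F] {u : ι → E} {v : ι → F}
    (h : ∃ T : E →L[ℂ] F, ∀ i, T (u i) = v i) (i : ι) : boundedExtension u v (u i) = v i := by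
  rw [boundedExtension, dif_pos h]
  exact h.choose_spec i

theorem pureCoord_eq_zero {l : List (RKHA p τ)} {a : List ℤ} (h : a.length ≠ l.length) :
    pureCoord l a = 0 := by
  induction l generalizing a with
  | nil => cases a with
    | nil => simp at h
    | cons j a => simp [pureCoord]
  | cons g l ih => cases a with
    | nil => simp [pureCoord]
    | cons j a => simp [pureCoord, ih (a := a) (by simpa using h)]

theorem pureCoord_replicate_kernelSection (x : Circ) (a : List ℤ) :
    pureCoord (List.replicate a.length (kernelSection p τ x)) a =
      (√(wordWeight p τ a) : ℂ) * fourier (-a.sum) x := by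
  induction a with
  | nil => simp [pureCoord, wordWeight]
  | cons j a ih =>
    have : wordWeight p τ (j :: a) = weight p τ j * wordWeight p τ a := by simp [wordWeight]
    rw [List.length_cons, List.replicate_succ, pureCoord, ih, coord_kernelSection, this,
      Real.sqrt_mul (weight_pos _ _ _).le, List.sum_cons, neg_add, fourier_add]
    push_cast
    ring

/-- The bounded extension that defines `comul` exists, as the weights are subconvolutive, so that
`comul` does not take its default value. -/
theorem comul_kernelSection (n : ℕ) (x : Circ) :
    comul p τ n (kernelSection p τ x) = pureTensor (List.replicate n (kernelSection p τ x)) := by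
  refine boundedExtension_apply (u := kernelSection p τ)
    (v := fun x => pureTensor (List.replicate n (kernelSection p τ x)))
    ⟨Fock.ofCoordMap (comulCoord p τ n) _ (comulCoord_bound n) (Real.sqrt_nonneg _), fun x => ?_⟩ x
  refine Fock.ext_coord fun a => ?_
  change comulCoord p τ n _ a = pureCoord _ a
  simp only [comulCoord, LinearMap.coe_mk, AddHom.coe_mk]
  split_ifs with h
  · subst h
    rw [pureCoord_replicate_kernelSection, coord_kernelSection, mul_right_comm,
      ← Complex.ofReal_mul, ← Real.sqrt_mul (weight_pos _ _ _).le,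
      mul_div_cancel₀ _ (weight_pos _ _ _).ne']
  · rw [pureCoord_eq_zero (by simpa using h)]

/-! ### The regularized generator and its evolution group -/

theorem fourier_add_right (j : ℤ) (x y : Circ) : fourier j (x + y) = fourier j x * fourier j y := by
  simp [fourier_apply, smul_add, AddCircle.toCircle_add]

theorem fourier_coe (j : ℤ) (s : ℝ) : fourier j (s : Circ) = Complex.exp (Complex.I * (j * s)) := by
  rw [fourier_coe_apply]
  congr 1
  have : (π : ℂ) ≠ 0 := by exact_mod_cast Real.pi_ne_zero
  push_cast
  field_simp

theorem toCont_psi (j : ℤ) : toCont (psi p τ j) = (√(weight p τ j) : ℂ) • fourier j :=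
  ContinuousMap.ext fun x => psi_apply j x

theorem restrictOp_psi (j : ℤ) :
    restrictOp p τ (psi p τ j) = (√(weight p τ j) : ℂ) • fourierLp 2 j := by
  rw [restrictOp, ContinuousLinearMap.comp_apply, toCont_psi, map_smul]

theorem koopman_coeFn {q : ℝ≥0∞} (α t : ℝ) (g : Lp ℂ q haar) :
    koopman α t g =ᵐ[haar] fun x => g (flow α t x) :=
  Lp.coeFn_compMeasurePreserving g (measurePreserving_flow α t)

theorem koopman_fourierLp (α t : ℝ) (c : ℂ) (j : ℤ) :
    koopman α t (c • fourierLp (T := 2 * π) 2 j) =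
      Complex.exp (t * (Complex.I * (α * j))) • c • fourierLp 2 j := by
  have h0 : (c • fourierLp (T := 2 * π) 2 j : Lp ℂ 2 haar) =ᵐ[haar] fun x => c * fourier j x := by
    filter_upwards [Lp.coeFn_smul c (fourierLp (T := 2 * π) 2 j), coeFn_fourierLp (T := 2 * π) 2 j]
      with x h1 h2
    rw [h1, Pi.smul_apply, h2, smul_eq_mul]
  refine Lp.ext ?_
  filter_upwards [koopman_coeFn α t (c • fourierLp (T := 2 * π) 2 j), h0,
    (measurePreserving_flow α t).quasiMeasurePreserving.ae h0,
    Lp.coeFn_smul (Complex.exp (t * (Complex.I * (α * j)))) (c • fourierLp (T := 2 * π) 2 j)]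
    with x h1 h2 h3 h4
  rw [h1, h3, h4, Pi.smul_apply, h2, flow, fourier_add_right, fourier_coe, smul_eq_mul]
  push_cast
  rw [show (t : ℂ) * (Complex.I * (α * j)) = Complex.I * (j * (α * t)) by ring]
  ring

theorem generator_fourierLp (α : ℝ) (c : ℂ) (j : ℤ) :
    generator α (c • fourierLp (T := 2 * π) 2 j) =
      (Complex.I * (α * j)) • c • fourierLp 2 j := by
  simp only [generator, koopman_fourierLp]
  refine HasDerivAt.deriv ?_
  have h : HasDerivAt (fun t : ℝ => Complex.exp (t * (Complex.I * (α * j))))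
      (Complex.I * (α * j)) 0 := by
    have := ((Complex.ofRealCLM.hasDerivAt (x := 0)).mul_const (Complex.I * (α * j))).cexp
    simpa using this
  exact h.smul_const _

theorem inner_WOp_psi (α : ℝ) (i j : ℤ) :
    ⟪psi p τ i, WOp p τ α (psi p τ j)⟫_ℂ =
      if i = j then Complex.I * (α * j * weight p τ j : ℝ) else 0 := by
  rw [WOp, kernelOp, ContinuousLinearMap.adjoint_inner_right, restrictOp_psi, restrictOp_psi,
    generator_fourierLp]
  simp only [inner_smul_left, inner_smul_right,
    (orthonormal_iff_ite.1 (orthonormal_fourier (T := 2 * π))) i j]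
  split_ifs with h
  · subst h
    have : ((√(weight p τ i) : ℝ) : ℂ) * (√(weight p τ i) : ℝ) = weight p τ i := by
      rw [← Complex.ofReal_mul, Real.mul_self_sqrt (weight_pos _ _ _).le]
    push_cast
    rw [← this]
    simp
    ring
  · simp

theorem freq_injective : Function.Injective freq := by
  intro i j h
  simp only [freq] at h
  split_ifs at h with h1 h2 h2 <;> simp only [Nat.even_iff] at h1 h2 <;> omega

/-- The eigenfrequency of `W_{τ,m}` at `ψ_j`: it is `α j λ_τ(j)` for `ψ_j` in `H_{τ,m}`, and `0` for
all other `j`. -/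
def eigFreq (p : Exponent) (τ : PosReal) (α : ℝ) (m : ℕ) (j : ℤ) : ℝ :=
  if j ∈ (Finset.range m).image freq then α * j * weight p τ j else 0

theorem eigFreq_freq (α : ℝ) {m i : ℕ} (hi : i < m) :
    eigFreq p τ α m (freq i) = α * freq i * weight p τ (freq i) :=
  if_pos (Finset.mem_image_of_mem _ (Finset.mem_range.2 hi))

theorem coord_sum {ι : Type*} (s : Finset ι) (F : ι → RKHA p τ) (k : ℤ) :
    (∑ i ∈ s, F i).coord k = ∑ i ∈ s, (F i).coord k := by
  simp_rw [← inner_psi]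
  exact inner_sum _ _ _

theorem coord_WFin (α : ℝ) (m : ℕ) (g : RKHA p τ) (k : ℤ) :
    (WFin p τ α m g).coord k = Complex.I * eigFreq p τ α m k * g.coord k := by
  have h1 : WFin p τ α m g = ∑ i ∈ Finset.range m,
      (Complex.I * (α * freq i * weight p τ (freq i) : ℝ) * g.coord (freq i)) •
        psi p τ (freq i) := by
    rw [WFin, _root_.sum_apply]
    refine Finset.sum_congr rfl fun i hi => ?_
    rw [_root_.sum_apply, Finset.sum_eq_single i]
    · rw [inner_WOp_psi, if_pos rfl, _root_.smul_apply, rankOne_apply, inner_psi,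
        smul_smul]
    · intro j _ hj
      rw [inner_WOp_psi, if_neg (freq_injective.ne hj.symm), zero_smul,
        _root_.zero_apply]
    · exact fun h => absurd hi h
  rw [h1, coord_sum]
  simp_rw [RKHA.coord_smul, coord_psi]
  by_cases hk : k ∈ (Finset.range m).image freq
  · obtain ⟨i, hi, rfl⟩ := Finset.mem_image.1 hk
    rw [Finset.sum_eq_single i]
    · rw [if_pos rfl, mul_one, eigFreq_freq α (Finset.mem_range.1 hi)]
    · intro j _ hj
      rw [if_neg (freq_injective.ne hj.symm), mul_zero]
    · exact fun h => absurd hi h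
  · rw [eigFreq, if_neg hk, Finset.sum_eq_zero]
    · simp
    · intro i hi
      rw [if_neg, mul_zero]
      rintro rfl
      exact hk (Finset.mem_image_of_mem _ hi)

/-- The phase by which `U^t_{τ,m}` multiplies the coordinate along `ψ_j`. -/
def phase (p : Exponent) (τ : PosReal) (α : ℝ) (m : ℕ) (t : ℝ) (j : ℤ) : ℂ :=
  Complex.exp (t * eigFreq p τ α m j * Complex.I)

theorem norm_phase (α : ℝ) (m : ℕ) (t : ℝ) (j : ℤ) : ‖phase p τ α m t j‖ = 1 := by
  rw [phase, ← Complex.ofReal_mul, Complex.norm_exp_ofReal_mul_I]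

theorem coord_exp {A : RKHA p τ →L[ℂ] RKHA p τ} {c : ℂ} {k : ℤ}
    (hA : ∀ g, (A g).coord k = c * g.coord k) (g : RKHA p τ) :
    ((NormedSpace.exp A) g).coord k = Complex.exp c * g.coord k := by
  have hpow : ∀ n : ℕ, ((A ^ n) g).coord k = c ^ n * g.coord k := by
    intro n
    induction n with
    | zero => simp
    | succ n ih =>
      rw [pow_succ']
      change (A ((A ^ n) g)).coord k = _
      rw [hA, ih]
      ring
  let L : (RKHA p τ →L[ℂ] RKHA p τ) →L[ℂ] ℂ :=
    (innerSL ℂ (psi p τ k)).comp (ContinuousLinearMap.apply ℂ (RKHA p τ) g)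
  have hL : ∀ B, L B = (B g).coord k := fun B => inner_psi k (B g)
  have h2 := L.hasSum (NormedSpace.exp_series_hasSum_exp' (𝕂 := ℂ) A)
  have h3 := (NormedSpace.exp_series_hasSum_exp' (𝕂 := ℂ) c).mul_right (g.coord k)
  rw [← Complex.exp_eq_exp_ℂ] at h3
  have h4 : ∀ n : ℕ, L ((n.factorial : ℂ)⁻¹ • A ^ n) =
      (n.factorial : ℂ)⁻¹ • c ^ n * g.coord k := by
    intro n
    rw [map_smul, hL, hpow, smul_eq_mul, smul_eq_mul, mul_assoc]
  simp_rw [h4, hL] at h2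
  exact h2.unique h3

theorem coord_UFin (α : ℝ) (m : ℕ) (t : ℝ) (g : RKHA p τ) (k : ℤ) :
    (UFin p τ α m t g).coord k = phase p τ α m t k * g.coord k := by
  refine coord_exp (fun g => ?_) g
  rw [_root_.smul_apply, RKHA.coord_smul, coord_WFin]
  ring

/-! ### Lifts to the Fock space -/

/-- An operator that is diagonal in the basis `ψ_j`, with unimodular entries, has a bounded lift to
the Fock space, which is diagonal in the basis of tensor products; so `fockLift` does not take its
default value. -/
theorem fockLift_pureTensor {U : RKHA p τ →L[ℂ] RKHA p τ} {u : ℤ → ℂ} (hu : ∀ j, ‖u j‖ = 1)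
    (hU : ∀ g j, (U g).coord j = u j * g.coord j) (l : List (RKHA p τ)) :
    fockLift U (pureTensor l) = pureTensor (l.map U) := by
  let c : Fock p τ →ₗ[ℂ] List ℤ → ℂ :=
    { toFun := fun F a => (a.map u).prod * F.coord a
      map_add' := fun F G => funext fun a => by
        simp only [Fock.coord_add, Pi.add_apply, mul_add]
      map_smul' := fun z F => funext fun a => by
        simp only [Fock.coord_smul, Pi.smul_apply, smul_eq_mul, RingHom.id_apply]
        ring }
  have hnorm : ∀ a : List ℤ, ‖(a.map u).prod‖ = 1 := fun a => by
    induction a with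
    | nil => simp
    | cons j a ih => simp [hu, ih]
  refine boundedExtension_apply (u := pureTensor (p := p) (τ := τ))
    (v := fun l => pureTensor (l.map U))
    ⟨Fock.ofCoordMap c 1 (fun F => ⟨‖F‖ ^ 2, by simp, ?_⟩) zero_le_one, fun l => ?_⟩ l
  · convert F.norm_sq_hasSum using 2 with a
    change ‖(a.map u).prod * F.coord a‖ ^ 2 = _
    rw [norm_mul, hnorm, one_mul]
  · refine Fock.ext_coord fun a => ?_
    change (a.map u).prod * pureCoord l a = pureCoord (l.map U) a
    induction l generalizing a with
    | nil => cases a <;> simp [pureCoord]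
    | cons g l ih =>
      cases a with
      | nil => simp [pureCoord]
      | cons j a =>
        rw [List.map_cons, pureCoord, List.map_cons, pureCoord, ← ih, hU, List.prod_cons]
        ring

/-! ### Von Mises densities and their roots in `H_τ` -/

/-- The unnormalized von Mises density `e^{s cos(x - θ)}`. -/
def expCos (s : ℝ) (θ x : Circ) : ℝ := Real.exp (s * Real.Angle.cos (x - θ))

theorem expCos_pos (s : ℝ) (θ x : Circ) : 0 < expCos s θ x := Real.exp_pos _

theorem continuous_expCos (s : ℝ) (θ : Circ) : Continuous (expCos s θ) :=
  Real.continuous_exp.comp (continuous_const.mul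
    (Real.Angle.continuous_cos.comp (continuous_id.sub continuous_const)))

/-- The trigonometric monomial `e^{ij·}` as an element of `H_τ`. -/
def mono (p : Exponent) (τ : PosReal) (j : ℤ) : RKHA p τ :=
  ((√(weight p τ j) : ℂ))⁻¹ • psi p τ j

theorem sqrt_weight_ne_zero (j : ℤ) : (√(weight p τ j) : ℂ) ≠ 0 := by
  exact_mod_cast (Real.sqrt_pos.2 (weight_pos p τ j)).ne'

theorem mono_apply (j : ℤ) (x : Circ) : mono p τ j x = fourier j x := by
  rw [mono, RKHS.coe_smul, Pi.smul_apply, psi_apply, smul_eq_mul,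
    inv_mul_cancel_left₀ (sqrt_weight_ne_zero j)]

theorem norm_psi (j : ℤ) : ‖psi p τ j‖ = 1 := by
  have h : ⟪psi p τ j, psi p τ j⟫_ℂ = 1 := by rw [inner_psi, coord_psi, if_pos rfl]
  have h2 := inner_self_eq_norm_sq (𝕜 := ℂ) (psi p τ j)
  rw [h, RCLike.one_re] at h2
  exact (pow_eq_one_iff_of_nonneg (norm_nonneg _) two_ne_zero).1 h2.symm

theorem norm_mono_le (j : ℤ) : ‖mono p τ j‖ ≤ Real.exp (τ / 2) ^ j.natAbs := by
  rw [mono, norm_smul, norm_psi, mul_one, norm_inv, Complex.norm_real,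
    Real.norm_of_nonneg (Real.sqrt_nonneg _), weight, ← Real.exp_half, ← Real.exp_neg,
    ← Real.exp_nat_mul]
  apply Real.exp_le_exp.2
  have h : |(j : ℝ)| ^ (p : ℝ) ≤ (j.natAbs : ℝ) := by
    rw [Nat.cast_natAbs, Int.cast_abs]
    rcases eq_or_ne j 0 with rfl | hj
    · simp [Real.zero_rpow p.2.1.ne']
    · have h1 : (1 : ℝ) ≤ |(j : ℝ)| := by exact_mod_cast Int.one_le_abs hj
      simpa using Real.rpow_le_rpow_of_exponent_le h1 p.2.2.le
  have := mul_le_mul_of_nonneg_left h τ.2.le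
  linarith

theorem ofReal_expCos (s : ℝ) (θ x : Circ) :
    (expCos s θ x : ℂ) = Complex.exp ((s / 2 : ℝ) * fourier 1 (x - θ)) *
      Complex.exp ((s / 2 : ℝ) * fourier (-1) (x - θ)) := by
  rw [expCos]
  induction x - θ using QuotientAddGroup.induction_on with
  | H y =>
    change ((Real.exp (s * Real.Angle.cos (y : Real.Angle)) : ℝ) : ℂ) =
      Complex.exp ((s / 2 : ℝ) * fourier 1 (y : Circ)) *
        Complex.exp ((s / 2 : ℝ) * fourier (-1) (y : Circ))
    rw [Real.Angle.cos_coe, fourier_coe, fourier_coe, ← Complex.exp_add, Complex.ofReal_exp]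
    congr 1
    push_cast
    rw [Complex.cos]
    ring_nf

theorem hasSum_exp_ofReal_mul (s : ℝ) (z : ℂ) :
    HasSum (fun k : ℕ => ((s ^ k / k.factorial : ℝ) : ℂ) * z ^ k) (Complex.exp (s * z)) := by
  have h := NormedSpace.expSeries_div_hasSum_exp (𝔸 := ℂ) (s * z)
  rw [← Complex.exp_eq_exp_ℂ] at h
  have h2 : (fun k : ℕ => ((s ^ k / k.factorial : ℝ) : ℂ) * z ^ k) =
      fun k : ℕ => (s * z) ^ k / (k.factorial : ℂ) := by
    funext k
    push_cast
    rw [mul_pow]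
    ring
  rw [h2]
  exact h

/-- The functions `e^{s cos(x - θ)}` belong to `H_τ`, since
`e^{s cos x} = ∑_{k,l} (s/2)^{k+l} / (k! l!) e^{i(k-l)x}` and the norm of `e^{ij·}` in `H_τ` grows
at most exponentially in `|j|`. The zeroth coordinate is the mean of the function. -/
theorem exists_coe_eq_expCos (p : Exponent) (τ : PosReal) (s : ℝ) (θ : Circ) :
    ∃ h : RKHA p τ, (∀ x, h x = (expCos s θ x : ℂ)) ∧ h.coord 0 = besselI 0 s := by
  let c : ℕ → ℝ := fun k => (s / 2) ^ k / k.factorial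
  let F : ℕ × ℕ → RKHA p τ := fun q =>
    ((c q.1 * c q.2 : ℝ) * fourier ((q.1 : ℤ) - q.2) (-θ) : ℂ) • mono p τ ((q.1 : ℤ) - q.2)
  have hF : Summable F := by
    have h1 : Summable fun k : ℕ => |s / 2 * Real.exp (τ / 2)| ^ k / (k.factorial : ℝ) :=
      Real.summable_pow_div_factorial _
    refine Summable.of_norm_bounded (h1.mul_of_nonneg h1 (fun _ => by positivity)
      fun _ => by positivity) fun q => ?_
    have hE : 1 ≤ Real.exp (τ / 2) := Real.one_le_exp (by have := τ.2; linarith)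
    calc ‖F q‖ ≤ |c q.1 * c q.2| * Real.exp (τ / 2) ^ (q.1 + q.2) := by
          simp only [F]
          rw [norm_smul, norm_mul, Complex.norm_real, Real.norm_eq_abs, fourier_apply,
            Circle.norm_coe, mul_one]
          gcongr
          exact (norm_mono_le _).trans (pow_le_pow_right₀ hE (by omega))
      _ = _ := by
          simp only [c]
          rw [abs_mul, abs_div, abs_div, abs_pow, abs_pow, abs_mul, pow_add,
            Nat.abs_cast, Nat.abs_cast, abs_of_pos (Real.exp_pos _), mul_pow, mul_pow]
          ring
  refine ⟨∑' q, F q, fun x => ?_, ?_⟩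
  · have h1 : HasSum (fun q => (F q) x) ((∑' q, F q : RKHA p τ) x) :=
      ((ContinuousLinearMap.proj (R := ℂ) x).comp
        (RKHS.coeCLM (H := RKHA p τ) (X := Circ) (V := ℂ) ℂ)).hasSum hF.hasSum
    have h2 : ∀ q, (F q) x = ((c q.1 : ℂ) * (fourier 1 (x - θ)) ^ q.1) *
        ((c q.2 : ℂ) * (fourier (-1) (x - θ)) ^ q.2) := by
      intro q
      simp only [F]
      have h3 : ∀ (j : ℤ) (k : ℕ) (y : Circ), (fourier j y) ^ k = fourier (k * j) y := by
        intro j k y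
        induction k with
        | zero => simp
        | succ k ih => rw [pow_succ, ih, ← fourier_add]; push_cast; rw [add_mul, one_mul]
      rw [RKHS.coe_smul, Pi.smul_apply, mono_apply, smul_eq_mul, h3, h3, sub_eq_add_neg,
        mul_assoc, ← fourier_add_right, mul_mul_mul_comm, ← fourier_add]
      push_cast
      rw [add_comm (-θ) x]
      simp [sub_eq_add_neg]
    simp_rw [h2] at h1
    rw [ofReal_expCos]
    exact ((hasSum_exp_ofReal_mul (s / 2) _).mul (hasSum_exp_ofReal_mul (s / 2) _)
      h1.summable).unique h1 |>.symm
  · have h1 : HasSum (fun q => (F q).coord 0) ((∑' q, F q : RKHA p τ).coord 0) := by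
      simp_rw [← inner_psi]
      exact (innerSL ℂ (psi p τ 0)).hasSum hF.hasSum
    have hinj : Function.Injective (fun k : ℕ => (k, k)) := fun k l h => (Prod.ext_iff.1 h).1
    have hc : ∀ q, (F q).coord 0 = if q.1 = q.2 then ((c q.1 * c q.2 : ℝ) : ℂ) else 0 := by
      intro q
      simp only [F, mono]
      rw [RKHA.coord_smul, RKHA.coord_smul, coord_psi]
      split_ifs with h2 h3 h3
      · simp [h3, weight_zero]
      · omega
      · omega
      · simp
    have h2 := (hinj.hasSum_iff (f := fun q => (F q).coord 0) (fun q hq => by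
      rw [hc, if_neg]
      intro h
      exact hq ⟨q.1, Prod.ext rfl h⟩)).2 h1
    have h3 : (fun q => (F q).coord 0) ∘ (fun k : ℕ => (k, k)) =
        fun k : ℕ =>
          (((s / 2) ^ (2 * k) / ((k.factorial : ℝ) * ((k + 0).factorial : ℝ)) : ℝ) : ℂ) := by
      funext k
      simp only [Function.comp, hc, if_true, c, add_zero]
      congr 1
      rw [two_mul, pow_add]
      field_simp
    rw [h3] at h2
    rw [← h2.tsum_eq, besselI, pow_zero, one_mul, Complex.ofReal_tsum]

theorem ofFun_eq {h : RKHA p τ} {g : Circ → ℂ} (H : ∀ x, h x = g x) : ofFun p τ g = h := by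
  have hg : (fun h : RKHA p τ => (h : Circ → ℂ)) h = g := funext H
  rw [ofFun, ← hg]
  exact Function.leftInverse_invFun DFunLike.coe_injective h

/-- The function `e^{s cos(x - θ)}` as an element of `H_τ`. -/
def expCosElem (p : Exponent) (τ : PosReal) (s : ℝ) (θ : Circ) : RKHA p τ :=
  (exists_coe_eq_expCos p τ s θ).choose

theorem expCosElem_apply (s : ℝ) (θ x : Circ) :
    expCosElem p τ s θ x = (expCos s θ x : ℂ) :=
  (exists_coe_eq_expCos p τ s θ).choose_spec.1 x

/-- The Fourier coefficients of an element of `H_τ` as a function on the circle. -/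
theorem coord_mul_sqrt_weight (h : RKHA p τ) (j : ℤ) :
    h.coord j * (√(weight p τ j) : ℂ) = ∫ x, fourier (-j) x * h x ∂haar := by
  rw [← fourierCoeff_toCont]
  simp only [fourierCoeff, smul_eq_mul]
  rfl

theorem integral_expCos (s : ℝ) (θ : Circ) : ∫ x, expCos s θ x ∂haar = besselI 0 s := by
  -- The integral depends neither on `p` nor on `τ`: any values serve to read it off in `H_τ`.
  let p : Exponent := ⟨1 / 2, by norm_num, by norm_num⟩
  let τ : PosReal := ⟨1, one_pos⟩
  have h := coord_mul_sqrt_weight (expCosElem p τ s θ) 0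
  have h1 : (expCosElem p τ s θ).coord 0 = besselI 0 s :=
    (exists_coe_eq_expCos p τ s θ).choose_spec.2
  simp only [h1, weight_zero, expCosElem_apply, neg_zero, fourier_zero, one_mul] at h
  rw [integral_complex_ofReal] at h
  simpa using h.symm

theorem integrable_expCos (s : ℝ) (θ : Circ) : Integrable (expCos s θ) haar :=
  (continuous_expCos s θ).integrable_of_hasCompactSupport
    (HasCompactSupport.of_compactSpace _)

theorem besselI_zero_pos (s : ℝ) : 0 < besselI 0 s := by
  rw [← integral_expCos s 0]
  refine (integral_pos_iff_support_of_nonneg (fun x => (expCos_pos s 0 x).le)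
    (integrable_expCos s 0)).2 ?_
  have : Function.support (expCos s 0) = Set.univ := Set.eq_univ_of_forall fun x =>
    (expCos_pos s 0 x).ne'
  simp [this]

theorem vonMises_eq (s : ℝ) (θ x : Circ) : vonMises θ s x = expCos s θ x / besselI 0 s := rfl

theorem exists_feature_eq (κ : ℝ) (θ : Circ) :
    ∃ c : ℝ, 0 < c ∧ feature p τ κ θ = (c : ℂ) • expCosElem p τ κ θ := by
  have hI := besselI_zero_pos κ
  have h1 : ofFun p τ (fun x => (vonMises θ κ x : ℂ)) =
      (((besselI 0 κ)⁻¹ : ℝ) : ℂ) • expCosElem p τ κ θ := by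
    refine ofFun_eq fun x => ?_
    rw [RKHS.coe_smul, Pi.smul_apply, expCosElem_apply, vonMises_eq, smul_eq_mul,
      ← Complex.ofReal_mul, div_eq_inv_mul]
  have h2 : expCosElem p τ κ θ ≠ 0 := by
    intro h
    have := expCosElem_apply (p := p) (τ := τ) κ θ 0
    rw [h, RKHS.coe_zero, Pi.zero_apply] at this
    exact (expCos_pos κ θ 0).ne (by exact_mod_cast this)
  have h3 : 0 < ‖ofFun p τ (fun x => (vonMises θ κ x : ℂ))‖ := by
    rw [h1, norm_pos_iff]
    exact smul_ne_zero (by exact_mod_cast (inv_pos.2 hI).ne') h2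
  refine ⟨‖ofFun p τ (fun x => (vonMises θ κ x : ℂ))‖⁻¹ * (besselI 0 κ)⁻¹, by positivity, ?_⟩
  rw [feature]
  nth_rw 2 [h1]
  rw [smul_smul, ← Complex.ofReal_mul]

/-- The `n`-th root of a von Mises feature vector with concentration `κ` is, up to a positive
factor, the function `e^{(κ / n) cos(x - θ)}`. -/
theorem exists_rkhaRoot_feature_eq (κ : ℝ) (θ : Circ) (n : ℕ) :
    ∃ c : ℝ, 0 < c ∧ rkhaRoot n (feature p τ κ θ) = (c : ℂ) • expCosElem p τ (κ / n) θ := by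
  obtain ⟨c, hc, h⟩ := exists_feature_eq (p := p) (τ := τ) κ θ
  refine ⟨c ^ (1 / (n : ℝ)), by positivity, ofFun_eq fun x => ?_⟩
  have hx := expCos_pos κ θ x
  have h1 : (1 / (n : ℂ)) = ((1 / (n : ℝ) : ℝ) : ℂ) := by push_cast; rfl
  rw [h, RKHS.coe_smul, Pi.smul_apply, expCosElem_apply, RKHS.coe_smul, Pi.smul_apply,
    expCosElem_apply, smul_eq_mul, smul_eq_mul, ← Complex.ofReal_mul, ← Complex.ofReal_mul, h1,
    ← Complex.ofReal_cpow (by positivity), Real.mul_rpow hc.le hx.le]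
  congr 2
  rw [expCos, expCos, ← Real.exp_mul]
  congr 1
  ring

/-! ### The spectral projection -/

theorem natAbs_freq (i : ℕ) : (freq i).natAbs = (i + 1) / 2 := by
  rw [freq]
  split_ifs with h <;> simp only [Nat.even_iff] at h <;> omega

theorem weight_le_weight_iff {j k : ℤ} :
    weight p τ k ≤ weight p τ j ↔ j.natAbs ≤ k.natAbs := by
  rw [weight, weight, Real.exp_le_exp, neg_mul, neg_mul, neg_le_neg_iff,
    mul_le_mul_iff_right₀ τ.2, Real.rpow_le_rpow_iff (abs_nonneg _) (abs_nonneg _) p.2.1]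
  rw [← Int.cast_abs, ← Int.cast_abs, Int.cast_le,
    Int.abs_eq_natAbs, Int.abs_eq_natAbs, Nat.cast_le]

theorem restrictOp_mono (j : ℤ) : restrictOp p τ (mono p τ j) = fourierLp 2 j := by
  rw [mono, map_smul, restrictOp_psi, smul_smul, inv_mul_cancel₀ (sqrt_weight_ne_zero j), one_smul]

theorem restrictOp_injective : Function.Injective (restrictOp p τ) := by
  intro g h hgh
  refine RKHS.ext (H := RKHA p τ) fun x => ?_
  have h1 : toCont g = toCont h := ContinuousMap.toLp_injective (p := 2) (𝕜 := ℂ) haar hgh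
  exact congrArg (fun F : C(Circ, ℂ) => F x) h1

theorem dirichletEnergy_fourierLp {c : ℂ} (hc : ‖c‖ = 1) (j : ℤ) :
    dirichletEnergy p τ (c • fourierLp 2 j) = (weight p τ j)⁻¹ - 1 := by
  have h1 : nystrom p τ (c • fourierLp 2 j) = c • mono p τ j := by
    rw [nystrom, ← restrictOp_mono, ← map_smul]
    exact Function.leftInverse_invFun restrictOp_injective _
  have h2 : ‖(fourierLp 2 j : Lp ℂ 2 haar)‖ = 1 := (orthonormal_fourier (T := 2 * π)).norm_eq_one j
  rw [dirichletEnergy, h1, norm_smul, norm_smul, hc, h2, mono, norm_smul, norm_psi, norm_inv,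
    Complex.norm_real, Real.norm_of_nonneg (Real.sqrt_nonneg _)]
  simp [Real.sq_sqrt (weight_pos p τ j).le]

/-- If the eigenfrequencies of `W_{τ,m}` are simple, then every eigenvector is a multiple of some
`ψ_j`. -/
theorem IsEigenbasis.exists_eq_smul_psi {α : ℝ} {m : ℕ} {ζ : Fin m → RKHA p τ}
    (h : IsEigenbasis p τ α m ζ)
    (hsimple : ∀ i < m, ∀ j < m, i ≠ j →
      eigFreq p τ α m (freq i) ≠ eigFreq p τ α m (freq j)) (k : Fin m) :
    ∃ i < m, ∃ c : ℂ, ‖c‖ = 1 ∧ ζ k = c • psi p τ (freq i) := by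
  have hsupp : ∀ j, (∀ i < m, j ≠ freq i) → (ζ k).coord j = 0 := by
    intro j hj
    have hmem := h.mem k
    generalize ζ k = g at hmem
    induction hmem using Submodule.span_induction with
    | mem g hg =>
      obtain ⟨i, hi, rfl⟩ := hg
      rw [coord_psi, if_neg (hj i hi)]
    | zero => rfl
    | add g g' _ _ h1 h2 => rw [RKHA.coord_add, h1, h2, add_zero]
    | smul c g _ h1 => rw [RKHA.coord_smul, h1, mul_zero]
  obtain ⟨ω, hω⟩ := h.eigen k
  have hfreq : ∀ j, (ζ k).coord j ≠ 0 → eigFreq p τ α m j = ω := by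
    intro j hj
    have h1 := coord_WFin α m (ζ k) j
    rw [hω, RKHA.coord_smul] at h1
    have h2 := mul_left_cancel₀ Complex.I_ne_zero (mul_right_cancel₀ hj h1)
    exact_mod_cast h2.symm
  have hnorm : ‖ζ k‖ = 1 := h.orthonormal.norm_eq_one k
  have hex : ∃ i < m, (ζ k).coord (freq i) ≠ 0 := by
    by_contra! hall
    have : ζ k = 0 := RKHA.ext_coord fun j => by
      by_cases hj : ∃ i < m, j = freq i
      · obtain ⟨i, hi, rfl⟩ := hj
        exact hall i hi
      · push Not at hj
        exact hsupp j hj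
    rw [this, norm_zero] at hnorm
    exact zero_ne_one hnorm
  obtain ⟨i, hi, hne⟩ := hex
  have heq : ζ k = (ζ k).coord (freq i) • psi p τ (freq i) := RKHA.ext_coord fun j => by
    rw [RKHA.coord_smul, coord_psi]
    split_ifs with hj
    · rw [hj, mul_one]
    · rw [mul_zero]
      by_contra hj0
      by_cases hj' : ∃ i' < m, j = freq i'
      · obtain ⟨i', hi', rfl⟩ := hj'
        refine hsimple i' hi' i hi (fun h => hj (h ▸ rfl)) ?_
        rw [hfreq _ hj0, hfreq _ hne]
      · push Not at hj'
        exact hj0 (hsupp j hj')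
  refine ⟨i, hi, (ζ k).coord (freq i), ?_, heq⟩
  have h1 := congrArg norm heq
  rwa [norm_smul, norm_psi, mul_one, hnorm, eq_comm] at h1

/-- If the eigenfrequencies of `W_{τ,m}` are simple, then ordering by the Dirichlet energy forces
the first `2d + 1` vectors of an eigenbasis to be the `ψ_j` with `|j| ≤ d`, up to phases. -/
theorem IsEigenbasis.ZProj_eq {α : ℝ} {m d : ℕ} {ζ : Fin m → RKHA p τ}
    (h : IsEigenbasis p τ α m ζ) (hd : 2 * d + 1 ≤ m)
    (hsimple : ∀ i < m, ∀ j < m, i ≠ j →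
      eigFreq p τ α m (freq i) ≠ eigFreq p τ α m (freq j)) :
    ZProj d m ζ = ∑ i ∈ Finset.range (2 * d + 1),
      rankOne ℂ (psi p τ (freq i)) (psi p τ (freq i)) := by
  choose σ hσm c hc hζ using h.exists_eq_smul_psi hsimple
  have hσ : Function.Injective σ := by
    intro k l hkl
    by_contra hne
    have h1 := h.orthonormal.inner_eq_zero hne
    rw [hζ k, hζ l, hkl, inner_smul_left, inner_smul_right, inner_psi, coord_psi, if_pos rfl,
      mul_one] at h1
    have h2 := congrArg norm h1
    rw [norm_mul, RCLike.norm_conj, hc, hc] at h2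
    simp at h2
  have hL2 : ∀ k, toL2Vec m (ζ k) = c k • fourierLp 2 (freq (σ k)) := by
    intro k
    rw [toL2Vec, Finset.sum_eq_single (σ k)]
    · rw [inner_psi, hζ k, RKHA.coord_smul, coord_psi, if_pos rfl, mul_one]
    · intro i _ hi
      rw [inner_psi, hζ k, RKHA.coord_smul, coord_psi, if_neg (freq_injective.ne hi), mul_zero,
        zero_smul]
    · exact fun hn => absurd (Finset.mem_range.2 (hσm k)) hn
  -- The energy of a phase times `ψ_j` is `1 / λ_τ(j) - 1`, which is strictly increasing in `|j|`.
  have hmono : ∀ k l, k ≤ l → (σ k + 1) / 2 ≤ (σ l + 1) / 2 := by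
    intro k l hkl
    have h1 := h.ordered hkl
    simp only [hL2, dirichletEnergy_fourierLp (hc _)] at h1
    rwa [sub_le_sub_iff_right, inv_le_inv₀ (weight_pos _ _ _) (weight_pos _ _ _),
      weight_le_weight_iff, natAbs_freq, natAbs_freq] at h1
  have hrange : Finset.univ.image σ = Finset.range m := by
    refine Finset.eq_of_subset_of_card_le (fun i hi => ?_) ?_
    · obtain ⟨k, -, rfl⟩ := Finset.mem_image.1 hi
      exact Finset.mem_range.2 (hσm k)
    · rw [Finset.card_image_of_injective _ hσ]
      simp
  have hle : ∀ k : Fin m, (k : ℕ) ≤ 2 * d → σ k < 2 * d + 1 := by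
    intro k hk
    by_contra! hlt
    -- Otherwise the `2d + 1` indices up to `2d` would all be attained before `k`.
    have hsub : Finset.range (2 * d + 1) ⊆ (Finset.Iio k).image σ := by
      intro i hi
      have hi' := Finset.mem_range.1 hi
      have him : i ∈ Finset.univ.image σ := by
        rw [hrange]
        exact Finset.mem_range.2 (by omega)
      obtain ⟨l, -, rfl⟩ := Finset.mem_image.1 him
      refine Finset.mem_image_of_mem _ (Finset.mem_Iio.2 ?_)
      by_contra! hkl
      have := hmono k l hkl
      omega
    have h1 := Finset.card_le_card hsub
    rw [Finset.card_image_of_injective _ hσ, Finset.card_range, Fin.card_Iio] at h1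
    omega
  have himage : (Finset.univ.filter fun k : Fin m => (k : ℕ) ≤ 2 * d).image σ =
      Finset.range (2 * d + 1) := by
    refine Finset.eq_of_subset_of_card_le (fun i hi => ?_) ?_
    · obtain ⟨k, hk, rfl⟩ := Finset.mem_image.1 hi
      exact Finset.mem_range.2 (hle k (Finset.mem_filter.1 hk).2)
    · rw [Finset.card_image_of_injective _ hσ, Finset.card_range]
      have h1 : (Finset.univ : Finset (Fin (2 * d + 1))).card ≤
          (Finset.univ.filter fun k : Fin m => (k : ℕ) ≤ 2 * d).card :=
        Finset.card_le_card_of_injOn (Fin.castLE hd)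
          (fun i _ => by simp; omega) (Fin.castLE_injective hd).injOn
      simpa using h1
  rw [← himage, Finset.sum_image hσ.injOn, ZProj]
  refine Finset.sum_congr rfl fun k _ => ?_
  refine ContinuousLinearMap.ext fun g => ?_
  have h1 : c k * starRingEnd ℂ (c k) = 1 := by
    rw [Complex.mul_conj, Complex.normSq_eq_norm_sq, hc]
    simp
  rw [rankOne_apply, rankOne_apply, hζ k, inner_smul_left, smul_smul, mul_right_comm,
    mul_comm _ (c k), h1, one_mul]

theorem tendsto_weight {ι : Type*} {l : Filter ι} {τ : ι → PosReal}
    (hτ : Tendsto (fun i => (τ i : ℝ)) l (𝓝 0)) (p : Exponent) (j : ℤ) :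
    Tendsto (fun i => weight p (τ i) j) l (𝓝 1) := by
  have h : Tendsto (fun i => Real.exp (-(τ i : ℝ) * |(j : ℝ)| ^ (p : ℝ))) l
      (𝓝 (Real.exp (-0 * |(j : ℝ)| ^ (p : ℝ)))) :=
    (Real.continuous_exp.tendsto _).comp (hτ.neg.mul_const _)
  rwa [neg_zero, zero_mul, Real.exp_zero] at h

theorem tendsto_eigFreq {ι : Type*} {l : Filter ι} {τ : ι → PosReal}
    (hτ : Tendsto (fun i => (τ i : ℝ)) l (𝓝 0)) (p : Exponent) (α : ℝ) {m k : ℕ} (hk : k < m) :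
    Tendsto (fun i => eigFreq p (τ i) α m (freq k)) l (𝓝 (α * freq k)) := by
  simp_rw [eigFreq_freq α hk]
  simpa using (tendsto_weight hτ p (freq k)).const_mul (α * freq k)

/-- For small `τ` the eigenfrequencies of `W_{τ,m}` are simple, being close to the distinct
frequencies of the rotation. -/
theorem eventually_eigFreq_ne {ι : Type*} {l : Filter ι} {τ : ι → PosReal}
    (hτ : Tendsto (fun i => (τ i : ℝ)) l (𝓝 0)) (p : Exponent) {α : ℝ} (hα : α ≠ 0) (m : ℕ) :
    ∀ᶠ e in l, ∀ i < m, ∀ j < m, i ≠ j →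
      eigFreq p (τ e) α m (freq i) ≠ eigFreq p (τ e) α m (freq j) := by
  have h : ∀ᶠ e in l, ∀ i ∈ Finset.range m, ∀ j ∈ Finset.range m, i ≠ j →
      eigFreq p (τ e) α m (freq i) ≠ eigFreq p (τ e) α m (freq j) := by
    rw [Finset.eventually_all]
    intro i hi
    rw [Finset.eventually_all]
    intro j hj
    by_cases hij : i = j
    · exact Eventually.of_forall fun _ h => absurd hij h
    · have hne : α * freq i ≠ α * freq j := fun h => hij <| freq_injective <| by
        exact_mod_cast mul_left_cancel₀ hα h
      filter_upwards [((tendsto_eigFreq hτ p α (Finset.mem_range.1 hi)).sub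
        (tendsto_eigFreq hτ p α (Finset.mem_range.1 hj))).eventually_ne
          (sub_ne_zero.2 hne)] with e he _
      exact sub_ne_zero.1 he
  filter_upwards [h] with e he i hi j hj
  exact he i (Finset.mem_range.2 hi) j (Finset.mem_range.2 hj)

/-! ### The prediction as a ratio of integrals -/

theorem fockExpectation_rankOne (u : Fock p τ) (A : Fock p τ →L[ℂ] Fock p τ) :
    fockExpectation (rankOne ℂ u u) A = ⟪u, A u⟫_ℂ := by
  rw [← ContinuousLinearMap.adjoint_inner_left, ← (inner_fock _ u).tsum_eq]
  refine tsum_congr fun a => ?_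
  rw [inner_pureTensor_psi, ContinuousLinearMap.comp_apply, rankOne_apply, Fock.coord_smul,
    ← ContinuousLinearMap.adjoint_inner_left, ← inner_conj_symm, inner_pureTensor_psi,
    RCLike.inner_apply, mul_comm]

theorem fockEvolve_rankOne (α : ℝ) (m : ℕ) (t : ℝ) (η : Fock p τ) :
    fockEvolve α m t (rankOne ℂ η η) =
      rankOne ℂ (ContinuousLinearMap.adjoint (fockLift (UFin p τ α m t)) η)
        (ContinuousLinearMap.adjoint (fockLift (UFin p τ α m t)) η) := by
  refine ContinuousLinearMap.ext fun F => ?_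
  simp only [fockEvolve, ContinuousLinearMap.comp_apply, rankOne_apply, map_smul,
    ContinuousLinearMap.adjoint_inner_left]

theorem multOp_coeFn (f : Lp ℂ ∞ haar) (v : Lp ℂ 2 haar) :
    multOp f v =ᵐ[haar] fun x => f x * v x :=
  (ContinuousLinearMap.mul ℂ ℂ).coeFn_holder (r := 2) f v

theorem inner_fockObservable (n : ℕ) (f : Lp ℂ ∞ haar) (u : Fock p τ) :
    ⟪u, fockObservable p τ n f u⟫_ℂ =
      ∫ x, f x * ((‖(ContinuousLinearMap.adjoint (comul p τ n) u) x‖ ^ 2 : ℝ) : ℂ) ∂haar := by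
  simp only [fockObservable, ContinuousLinearMap.comp_apply, kernelOp]
  rw [← ContinuousLinearMap.adjoint_inner_left, ContinuousLinearMap.adjoint_inner_right,
    L2.inner_def]
  set g := ContinuousLinearMap.adjoint (comul p τ n) u
  have hg : (restrictOp p τ g : Lp ℂ 2 haar) =ᵐ[haar] fun x => g x :=
    ContinuousMap.coeFn_toLp (p := 2) (𝕜 := ℂ) haar (toCont g)
  refine integral_congr_ae ?_
  filter_upwards [hg, multOp_coeFn f (restrictOp p τ g)] with x h1 h2
  rw [h2, h1, RCLike.inner_apply, mul_assoc, Complex.mul_conj, Complex.normSq_eq_norm_sq]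

theorem inner_pureTensor_replicate (n : ℕ) (g h : RKHA p τ) :
    ⟪pureTensor (List.replicate n g), pureTensor (List.replicate n h)⟫_ℂ = ⟪g, h⟫_ℂ ^ n := by
  induction n with
  | zero => simpa using inner_pureTensor_nil
  | succ n ih => rw [List.replicate_succ, List.replicate_succ, inner_pureTensor_cons, ih, pow_succ']

theorem norm_pureTensor_replicate (n : ℕ) (g : RKHA p τ) :
    ‖pureTensor (List.replicate n g)‖ = ‖g‖ ^ n := by
  have h1 := inner_pureTensor_replicate n g g
  rw [inner_self_eq_norm_sq_to_K, inner_self_eq_norm_sq_to_K] at h1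
  have h2 : ‖pureTensor (List.replicate n g)‖ ^ 2 = (‖g‖ ^ 2) ^ n := by exact_mod_cast h1
  rw [← pow_mul, mul_comm, pow_mul] at h2
  exact (sq_eq_sq₀ (norm_nonneg _) (by positivity)).1 h2

theorem norm_projRoot_le (d m : ℕ) (ζ : Fin m → RKHA p τ) (ξ : RKHA p τ) (n : ℕ) :
    ‖projRoot d m ζ ξ n‖ ≤ 1 := by
  rw [projRoot, norm_smul, Complex.norm_real, norm_inv, norm_norm]
  exact inv_mul_le_one

theorem summable_fockFeature {w : ℕ+ → ℝ} (hw : Summable w) (hw0 : ∀ n, 0 < w n)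
    (κ : ℝ) (d m : ℕ) (ζ : Fin m → RKHA p τ) (θ : Circ) :
    Summable fun n : ℕ+ => (w n : ℂ) •
      pureTensor (List.replicate (n : ℕ) (projRoot d m ζ (feature p τ κ θ) n)) := by
  refine Summable.of_norm_bounded hw fun n => ?_
  rw [norm_smul, Complex.norm_real, Real.norm_of_nonneg (hw0 n).le, norm_pureTensor_replicate]
  exact mul_le_of_le_one_right (hw0 n).le (pow_le_one₀ (norm_nonneg _) (norm_projRoot_le _ _ _ _ _))

theorem adjoint_comul_apply (n : ℕ) (F : Fock p τ) (x : Circ) :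
    (ContinuousLinearMap.adjoint (comul p τ n) F) x =
      ⟪pureTensor (List.replicate n (kernelSection p τ x)), F⟫_ℂ := by
  rw [← comul_kernelSection, ← ContinuousLinearMap.adjoint_inner_right, kernelSection,
    RKHS.kerFun_inner]
  simp

/-- Only the grade `n` of the Fock space feature vector is seen by the `n`-fold comultiplication,
whose adjoint multiplies the tensor factors pointwise. -/
theorem adjoint_comul_fockFeature {w : ℕ+ → ℝ} (hw : Summable w) (hw0 : ∀ n, 0 < w n)
    (α t κ : ℝ) (d m : ℕ) (ζ : Fin m → RKHA p τ) (θ : Circ) (n : ℕ+) (x : Circ) :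
    (ContinuousLinearMap.adjoint (comul p τ n)
      (ContinuousLinearMap.adjoint (fockLift (UFin p τ α m t)) (fockFeature w κ d m ζ θ))) x =
      w n * ⟪UFin p τ α m t (kernelSection p τ x),
        projRoot d m ζ (feature p τ κ θ) n⟫_ℂ ^ (n : ℕ) := by
  rw [adjoint_comul_apply, ContinuousLinearMap.adjoint_inner_right,
    fockLift_pureTensor (norm_phase α m t) (coord_UFin α m t), List.map_replicate, fockFeature]
  have h1 := (innerSL ℂ (pureTensor (List.replicate (n : ℕ)
    (UFin p τ α m t (kernelSection p τ x))))).hasSum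
      (summable_fockFeature hw hw0 κ d m ζ θ).hasSum
  refine (HasSum.tsum_eq h1).symm.trans ?_
  rw [tsum_eq_single n]
  · rw [map_smul, innerSL_apply_apply, inner_pureTensor_replicate, smul_eq_mul]
  · intro k hk
    rw [map_smul, innerSL_apply_apply, inner_pureTensor_of_length_ne, smul_zero]
    simpa using hk.symm

/-- The trigonometric polynomial of degree at most `d` obtained from `e^{s cos(x - θ)}` by
truncating its Fourier series and applying the adjoint of `U^t_{τ,m}`. -/
def evolvedTrunc (p : Exponent) (τ : PosReal) (α : ℝ) (m : ℕ) (t : ℝ) (d : ℕ) (s : ℝ)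
    (θ x : Circ) : ℂ :=
  ∑ i ∈ Finset.range (2 * d + 1), starRingEnd ℂ (phase p τ α m t (freq i)) *
    (∫ y, fourier (-freq i) y * (expCos s θ y : ℂ) ∂haar) * fourier (freq i) x

theorem inner_UFin_kernelSection_psi (α : ℝ) (m : ℕ) (t : ℝ) (j : ℤ) (x : Circ) :
    ⟪UFin p τ α m t (kernelSection p τ x), psi p τ j⟫_ℂ =
      starRingEnd ℂ (phase p τ α m t j) * (√(weight p τ j) : ℂ) * fourier j x := by
  rw [← inner_conj_symm, inner_psi, coord_UFin, coord_kernelSection]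
  simp [mul_assoc]

/-- The value at `x` of the evolved root vector is, up to a positive factor that does not depend on
`x`, that of the trigonometric polynomial `evolvedTrunc`. -/
theorem exists_inner_projRoot_eq {α : ℝ} {m d : ℕ} {ζ : Fin m → RKHA p τ}
    (hζ : IsEigenbasis p τ α m ζ) (hd : 2 * d + 1 ≤ m)
    (hsimple : ∀ i < m, ∀ j < m, i ≠ j →
      eigFreq p τ α m (freq i) ≠ eigFreq p τ α m (freq j)) (t κ : ℝ) (θ : Circ) (n : ℕ) :
    ∃ r : ℝ, 0 < r ∧ ∀ x, ⟪UFin p τ α m t (kernelSection p τ x),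
        projRoot d m ζ (feature p τ κ θ) n⟫_ℂ = r * evolvedTrunc p τ α m t d (κ / n) θ x := by
  obtain ⟨c, hc, hroot⟩ := exists_rkhaRoot_feature_eq (p := p) (τ := τ) κ θ n
  have hZ : ZProj d m ζ (rkhaRoot n (feature p τ κ θ)) = (c : ℂ) •
      ∑ i ∈ Finset.range (2 * d + 1),
        (expCosElem p τ (κ / n) θ).coord (freq i) • psi p τ (freq i) := by
    rw [hroot, map_smul, hζ.ZProj_eq hd hsimple, _root_.sum_apply]
    simp only [rankOne_apply, inner_psi]
  have h0 : freq 0 = 0 := by simp [freq]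
  -- The coordinate along `ψ_0` is a multiple of `I_0(κ / n) > 0`, so the normalization is genuine.
  have hZ0 : ZProj d m ζ (rkhaRoot n (feature p τ κ θ)) ≠ 0 := by
    intro h
    have h1 : (ZProj d m ζ (rkhaRoot n (feature p τ κ θ))).coord 0 =
        (c : ℂ) * besselI 0 (κ / n) := by
      rw [hZ, RKHA.coord_smul, coord_sum, Finset.sum_eq_single 0]
      · rw [RKHA.coord_smul, h0, coord_psi, if_pos rfl, mul_one]
        congr 1
        exact (exists_coe_eq_expCos p τ (κ / n) θ).choose_spec.2
      · intro i _ hi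
        rw [RKHA.coord_smul, coord_psi, if_neg, mul_zero]
        rw [← h0]
        exact freq_injective.ne hi.symm
      · simp
    rw [h] at h1
    have h2 := besselI_zero_pos (κ / n)
    have h3 : ((c * besselI 0 (κ / n) : ℝ) : ℂ) = 0 := by
      push_cast
      exact h1.symm
    exact (mul_pos hc h2).ne' (by exact_mod_cast h3)
  refine ⟨‖ZProj d m ζ (rkhaRoot n (feature p τ κ θ))‖⁻¹ * c,
    mul_pos (inv_pos.2 (norm_pos_iff.2 hZ0)) hc, fun x => ?_⟩
  rw [projRoot, inner_smul_right]
  nth_rw 2 [hZ]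
  rw [inner_smul_right, inner_sum, evolvedTrunc, Complex.ofReal_mul, mul_assoc]
  congr 2
  refine Finset.sum_congr rfl fun i _ => ?_
  have h1 := coord_mul_sqrt_weight (expCosElem p τ (κ / n) θ) (freq i)
  simp only [expCosElem_apply] at h1
  rw [inner_smul_right, inner_UFin_kernelSection_psi, ← h1]
  ring

/-- The scalar factors of the feature vector cancel, so that the prediction is the average of `f`
with respect to the density proportional to `|P|^{2n}`, for the trigonometric polynomial `P`. -/
theorem fockPrediction_eq {α : ℝ} {m d : ℕ} {ζ : Fin m → RKHA p τ}
    (hζ : IsEigenbasis p τ α m ζ) (hd : 2 * d + 1 ≤ m)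
    (hsimple : ∀ i < m, ∀ j < m, i ≠ j →
      eigFreq p τ α m (freq i) ≠ eigFreq p τ α m (freq j)) {w : ℕ+ → ℝ} (hw : Summable w)
    (hw0 : ∀ n, 0 < w n) (t κ : ℝ) {n : ℕ} (hn : 0 < n) (f : Lp ℂ ∞ haar) (θ : Circ) :
    fockPrediction α t w κ n d m ζ f θ =
      (∫ x, f x * ((‖evolvedTrunc p τ α m t d (κ / n) θ x ^ n‖ ^ 2 : ℝ) : ℂ) ∂haar) /
        ∫ x, ((‖evolvedTrunc p τ α m t d (κ / n) θ x ^ n‖ ^ 2 : ℝ) : ℂ) ∂haar := by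
  obtain ⟨r, hr, hP⟩ := exists_inner_projRoot_eq hζ hd hsimple t κ θ n
  have hwn := hw0 ⟨n, hn⟩
  have key : ∀ g : Lp ℂ ∞ haar,
      fockExpectation (fockEvolve α m t (quantumFeature w κ d m ζ θ)) (fockObservable p τ n g) =
        (((w ⟨n, hn⟩ * r ^ n) ^ 2 : ℝ) : ℂ) *
          ∫ x, g x * ((‖evolvedTrunc p τ α m t d (κ / n) θ x ^ n‖ ^ 2 : ℝ) : ℂ) ∂haar := by
    intro g
    rw [quantumFeature, fockEvolve_rankOne, fockExpectation_rankOne, inner_fockObservable,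
      ← integral_const_mul]
    refine integral_congr_ae (Eventually.of_forall fun x => ?_)
    have h1 := adjoint_comul_fockFeature hw hw0 α t κ d m ζ θ ⟨n, hn⟩ x
    simp only [PNat.mk_coe] at h1
    simp only [h1, hP, mul_pow, norm_mul, norm_pow, Complex.norm_real,
      Real.norm_of_nonneg hwn.le, Real.norm_of_nonneg hr.le]
    push_cast
    ring
  have hne : (((w ⟨n, hn⟩ * r ^ n) ^ 2 : ℝ) : ℂ) ≠ 0 := by
    exact_mod_cast (by positivity : (0 : ℝ) < (w ⟨n, hn⟩ * r ^ n) ^ 2).ne'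
  rw [fockPrediction, key, key, mul_div_mul_left _ _ hne]
  congr 1
  refine integral_congr_ae ?_
  filter_upwards [Lp.coeFn_const (μ := haar) (p := ∞) (1 : ℂ)] with x hx
  rw [hx, Function.const_apply, one_mul]

/-! ### Approximation of `e^{s cos(x - θ)}` for small `s` -/

/-- The `j`-th Fourier coefficient, as a functional on continuous functions. -/
def coeffCLM (j : ℤ) : C(Circ, ℂ) →L[ℂ] ℂ :=
  (innerSL ℂ (fourierLp 2 j : Lp ℂ 2 haar)) ∘L (ContinuousMap.toLp 2 haar ℂ)

theorem coeffCLM_apply (j : ℤ) (F : C(Circ, ℂ)) :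
    coeffCLM j F = ∫ y, fourier (-j) y * F y ∂haar := by
  have h : coeffCLM j F = fourierCoeff F j := by
    rw [← fourierCoeff_toLp, ← fourierBasis_repr, HilbertBasis.repr_apply_apply, coe_fourierBasis]
    rfl
  rw [h]
  simp [fourierCoeff]

theorem norm_fourier_apply (j : ℤ) (x : Circ) : ‖(fourier j x : ℂ)‖ = 1 := by
  rw [fourier_apply, Circle.norm_coe]

theorem coeffCLM_fourier (j k : ℤ) : coeffCLM j (fourier k) = if j = k then 1 else 0 :=
  (orthonormal_iff_ite.1 (orthonormal_fourier (T := 2 * π))) j k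

theorem norm_coeffCLM_le (j : ℤ) {F : C(Circ, ℂ)} {C : ℝ} (hF : ∀ x, ‖F x‖ ≤ C) :
    ‖coeffCLM j F‖ ≤ C := by
  rw [coeffCLM_apply]
  have h := norm_integral_le_of_norm_le_const (μ := (haar : Measure Circ)) (C := C)
    (f := fun y => fourier (-j) y * F y) (Eventually.of_forall fun y => by
      rw [norm_mul, norm_fourier_apply, one_mul]
      exact hF y)
  simpa using h

/-- The function `e^{s cos(x - θ)}` as a continuous function with complex values. -/
def expCosCont (s : ℝ) (θ : Circ) : C(Circ, ℂ) :=
  ⟨fun x => (expCos s θ x : ℂ), Complex.continuous_ofReal.comp (continuous_expCos s θ)⟩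

/-- The first-order approximation `1 + s cos(x - θ)` of `e^{s cos(x - θ)}`. -/
def linCosCont (s : ℝ) (θ : Circ) : C(Circ, ℂ) :=
  fourier 0 + ((s / 2 : ℝ) : ℂ) • (fourier (-1) θ • fourier 1 + fourier 1 θ • fourier (-1))

theorem linCosCont_apply (s : ℝ) (θ x : Circ) : linCosCont s θ x =
    1 + ((s / 2 : ℝ) : ℂ) * (fourier (-1) θ * fourier 1 x + fourier 1 θ * fourier (-1) x) := by
  rw [← fourier_zero (x := x)]
  rfl

theorem ofReal_cos_sub (θ x : Circ) :
    ((Real.Angle.cos (x - θ) : ℝ) : ℂ) =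
      (fourier (-1) θ * fourier 1 x + fourier 1 θ * fourier (-1) x) / 2 := by
  have h1 : fourier (-1) θ * fourier 1 x = fourier 1 (x - θ) := by
    rw [sub_eq_add_neg, fourier_add_right, mul_comm]
    simp
  have h2 : fourier 1 θ * fourier (-1) x = fourier (-1) (x - θ) := by
    rw [sub_eq_add_neg, fourier_add_right, mul_comm]
    simp
  rw [h1, h2]
  induction x - θ using QuotientAddGroup.induction_on with
  | H y =>
    change ((Real.Angle.cos (y : Real.Angle) : ℝ) : ℂ) =
      (fourier 1 (y : Circ) + fourier (-1) (y : Circ)) / 2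
    rw [Real.Angle.cos_coe, fourier_coe, fourier_coe, Complex.ofReal_cos, Complex.cos]
    push_cast
    ring_nf

theorem abs_angle_cos_le (x : Real.Angle) : |Real.Angle.cos x| ≤ 1 := by
  induction x using Real.Angle.induction_on with
  | h y => exact Real.abs_cos_le_one y

theorem norm_expCosCont_sub_linCosCont_le {s : ℝ} (hs : |s| ≤ 1) (θ x : Circ) :
    ‖(expCosCont s θ - linCosCont s θ) x‖ ≤ s ^ 2 := by
  have h1 : (expCosCont s θ - linCosCont s θ) x =
      ((Real.exp (s * Real.Angle.cos (x - θ)) - 1 - s * Real.Angle.cos (x - θ) : ℝ) : ℂ) := by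
    change (expCos s θ x : ℂ) - linCosCont s θ x = _
    rw [linCosCont_apply, Complex.ofReal_sub, Complex.ofReal_sub, Complex.ofReal_mul s,
      ofReal_cos_sub, expCos]
    push_cast
    ring
  have h2 : |s * Real.Angle.cos (x - θ)| ≤ |s| := by
    rw [abs_mul]
    exact mul_le_of_le_one_right (abs_nonneg _) (abs_angle_cos_le _)
  rw [h1, Complex.norm_real]
  refine (Real.norm_exp_sub_one_sub_id_le (h2.trans hs)).trans ?_
  rw [Real.norm_eq_abs, ← sq_abs s]
  gcongr

theorem norm_coeffCLM_expCosCont_le {s : ℝ} (hs : |s| ≤ 1) (θ : Circ) {j : ℤ} (hj : j ≠ 0) :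
    ‖coeffCLM j (expCosCont s θ)‖ ≤ 2 * |s| := by
  have h1 := norm_coeffCLM_le j (norm_expCosCont_sub_linCosCont_le hs θ)
  have h2 : ‖coeffCLM j (linCosCont s θ)‖ ≤ |s| := by
    simp only [linCosCont, map_add, map_smul, coeffCLM_fourier, smul_eq_mul, if_neg hj, zero_add]
    rw [norm_mul, Complex.norm_real, Real.norm_eq_abs, abs_div, abs_two]
    have h3 : ‖(fourier (-1) θ : ℂ) * (if j = 1 then 1 else 0) +
        fourier 1 θ * (if j = -1 then 1 else 0)‖ ≤ 2 := by
      refine (norm_add_le _ _).trans ?_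
      rw [norm_mul, norm_mul, norm_fourier_apply, norm_fourier_apply]
      split_ifs <;> norm_num
    nlinarith [abs_nonneg s]
  have h4 : s ^ 2 ≤ |s| := by
    rw [← sq_abs]
    nlinarith [abs_nonneg s]
  have h5 : coeffCLM j (expCosCont s θ) =
      coeffCLM j (expCosCont s θ - linCosCont s θ) + coeffCLM j (linCosCont s θ) := by
    rw [← map_add, sub_add_cancel]
  rw [h5]
  linarith [norm_add_le (coeffCLM j (expCosCont s θ - linCosCont s θ))
    (coeffCLM j (linCosCont s θ))]

/-- The truncated Fourier series `∑_{|j| ≤ d}`. -/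
def fourierTrunc (d : ℕ) : C(Circ, ℂ) →ₗ[ℂ] C(Circ, ℂ) :=
  ∑ i ∈ Finset.range (2 * d + 1), (coeffCLM (freq i)).toLinearMap.smulRight (fourier (freq i))

theorem fourierTrunc_apply (d : ℕ) (F : C(Circ, ℂ)) (x : Circ) :
    fourierTrunc d F x =
      ∑ i ∈ Finset.range (2 * d + 1), coeffCLM (freq i) F * fourier (freq i) x := by
  simp [fourierTrunc]

theorem fourierTrunc_fourier_freq {d i : ℕ} (hi : i < 2 * d + 1) :
    fourierTrunc d (fourier (freq i)) = fourier (freq i) := by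
  ext x
  rw [fourierTrunc_apply, Finset.sum_eq_single i]
  · rw [coeffCLM_fourier, if_pos rfl, one_mul]
  · intro j _ hj
    rw [coeffCLM_fourier, if_neg (freq_injective.ne hj), zero_mul]
  · exact fun h => absurd (Finset.mem_range.2 hi) h

theorem fourierTrunc_linCosCont {d : ℕ} (hd : 1 ≤ d) (s : ℝ) (θ : Circ) :
    fourierTrunc d (linCosCont s θ) = linCosCont s θ := by
  have h0 := fourierTrunc_fourier_freq (d := d) (i := 0) (by omega)
  have h1 := fourierTrunc_fourier_freq (d := d) (i := 1) (by omega)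
  have h2 := fourierTrunc_fourier_freq (d := d) (i := 2) (by omega)
  rw [show freq 0 = 0 by simp [freq]] at h0
  rw [show freq 1 = 1 by simp [freq]] at h1
  rw [show freq 2 = -1 by simp [freq]] at h2
  simp only [linCosCont, map_add, map_smul, h0, h1, h2]

/-- Truncation is exact on `1 + s cos(x - θ)`, so it only affects the remainder, which is bounded by
`s ^ 2`. -/
theorem norm_fourierTrunc_sub_le {d : ℕ} (hd : 1 ≤ d) {s : ℝ} (hs : |s| ≤ 1) (θ x : Circ) :
    ‖fourierTrunc d (expCosCont s θ) x - expCosCont s θ x‖ ≤ (2 * d + 2) * s ^ 2 := by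
  set R := expCosCont s θ - linCosCont s θ with hR
  have hb := norm_expCosCont_sub_linCosCont_le hs θ
  have h1 : fourierTrunc d (expCosCont s θ) x - expCosCont s θ x = fourierTrunc d R x - R x := by
    rw [hR, map_sub, fourierTrunc_linCosCont hd, ContinuousMap.sub_apply, ContinuousMap.sub_apply]
    ring
  have h2 : ‖fourierTrunc d R x‖ ≤ (2 * d + 1) * s ^ 2 := by
    rw [fourierTrunc_apply]
    refine (norm_sum_le_of_le (Finset.range (2 * d + 1)) (fun i _ => ?_)).trans_eq
      (b := ∑ i ∈ Finset.range (2 * d + 1), s ^ 2) ?_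
    · rw [norm_mul, norm_fourier_apply, mul_one]
      exact norm_coeffCLM_le _ hb
    · simp
  rw [h1]
  linarith [norm_sub_le (fourierTrunc d R x) (R x), hb x]

/-- The deviation of the phases of the adjoint of `U^t_{τ,m}` from those of the rotation by `-αt`,
summed over the frequencies `|j| ≤ d`. -/
def phaseError (p : Exponent) (τ : PosReal) (α : ℝ) (m : ℕ) (t : ℝ) (d : ℕ) : ℝ :=
  ∑ i ∈ Finset.range (2 * d + 1), ‖starRingEnd ℂ (phase p τ α m t (freq i)) -
    fourier (freq i) (-((α * t : ℝ) : Circ))‖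

theorem expCos_sub (s : ℝ) (θ x y : Circ) : expCos s θ (x - y) = expCos s (θ + y) x := by
  rw [expCos, expCos, sub_sub, add_comm y θ]

/-- The constant mode is fixed both by `U^t_{τ,m}` and by the rotation. -/
theorem conj_phase_sub_of_freq_eq_zero (α : ℝ) (m : ℕ) (t : ℝ) :
    starRingEnd ℂ (phase p τ α m t 0) - fourier 0 (-((α * t : ℝ) : Circ)) = 0 := by
  have : eigFreq p τ α m 0 = 0 := by simp [eigFreq]
  simp [phase, this]

/-- The zeroth frequency does not contribute to the phase error, and all other Fourier coefficients
are `O(s)`; the truncation error is `O(s ^ 2)`. -/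
theorem norm_evolvedTrunc_sub_le (α : ℝ) (m : ℕ) (t : ℝ) {d : ℕ} (hd : 1 ≤ d) {s : ℝ}
    (hs : |s| ≤ 1) (θ x : Circ) :
    ‖evolvedTrunc p τ α m t d s θ x - (expCos s (θ + ((α * t : ℝ) : Circ)) x : ℂ)‖ ≤
      2 * |s| * phaseError p τ α m t d + (2 * d + 2) * s ^ 2 := by
  set y : Circ := ((α * t : ℝ) : Circ) with hy
  have h1 : evolvedTrunc p τ α m t d s θ x - (expCos s (θ + y) x : ℂ) =
      (∑ i ∈ Finset.range (2 * d + 1), (starRingEnd ℂ (phase p τ α m t (freq i)) -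
        fourier (freq i) (-y)) * coeffCLM (freq i) (expCosCont s θ) * fourier (freq i) x) +
      (fourierTrunc d (expCosCont s θ) (x - y) - expCosCont s θ (x - y)) := by
    have h2 : expCosCont s θ (x - y) = (expCos s (θ + y) x : ℂ) := by
      rw [← expCos_sub]
      rfl
    have h3 : evolvedTrunc p τ α m t d s θ x = ∑ i ∈ Finset.range (2 * d + 1),
        starRingEnd ℂ (phase p τ α m t (freq i)) * coeffCLM (freq i) (expCosCont s θ) *
          fourier (freq i) x := by
      simp_rw [coeffCLM_apply]
      rfl
    rw [h2, h3, fourierTrunc_apply, ← add_sub_assoc, ← Finset.sum_add_distrib]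
    congr 1
    refine Finset.sum_congr rfl fun i _ => ?_
    rw [sub_eq_add_neg x y, fourier_add_right]
    ring
  rw [h1]
  refine (norm_add_le _ _).trans (add_le_add ?_ (norm_fourierTrunc_sub_le hd hs θ _))
  rw [phaseError, Finset.mul_sum]
  refine norm_sum_le_of_le _ fun i _ => ?_
  rw [norm_mul, norm_mul, norm_fourier_apply (freq i) x, mul_one, mul_comm]
  by_cases hi : freq i = 0
  · rw [hi, hy, conj_phase_sub_of_freq_eq_zero]
    simp
  · gcongr
    exact norm_coeffCLM_expCosCont_le hs θ hi

theorem tendsto_phaseError {ι : Type*} {l : Filter ι} {τ : ι → PosReal}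
    (hτ : Tendsto (fun i => (τ i : ℝ)) l (𝓝 0)) (p : Exponent) (α t : ℝ) {m d : ℕ}
    (hd : 2 * d + 1 ≤ m) : Tendsto (fun e => phaseError p (τ e) α m t d) l (𝓝 0) := by
  rw [← Finset.sum_const_zero (ι := ℕ) (s := Finset.range (2 * d + 1))]
  refine tendsto_finsetSum _ fun i hi => ?_
  have hi' : i < m := by
    have := Finset.mem_range.1 hi
    omega
  have h1 : Tendsto (fun e => starRingEnd ℂ (phase p (τ e) α m t (freq i))) l
      (𝓝 (starRingEnd ℂ (Complex.exp (t * (α * freq i : ℝ) * Complex.I)))) := by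
    refine (Complex.continuous_conj.tendsto _).comp ((Complex.continuous_exp.tendsto _).comp ?_)
    exact (((Complex.continuous_ofReal.tendsto _).comp
      (tendsto_eigFreq hτ p α hi')).const_mul (t : ℂ)).mul_const Complex.I
  have h2 : starRingEnd ℂ (Complex.exp (t * (α * freq i : ℝ) * Complex.I)) =
      fourier (freq i) (-((α * t : ℝ) : Circ)) := by
    rw [← AddCircle.coe_neg, fourier_coe, ← Complex.exp_conj]
    congr 1
    simp
    ring
  rw [h2] at h1
  simpa using (h1.sub_const (fourier (freq i) (-((α * t : ℝ) : Circ)))).norm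

theorem norm_pow_sub_pow_le_of_norm_le {a b : ℂ} {M : ℝ} (hM : 1 ≤ M) (ha : ‖a‖ ≤ M)
    (hb : ‖b‖ ≤ M) (n : ℕ) : ‖a ^ n - b ^ n‖ ≤ n * M ^ n * ‖a - b‖ := by
  induction n with
  | zero => simp
  | succ n ih =>
    have h1 : a ^ (n + 1) - b ^ (n + 1) = a * (a ^ n - b ^ n) + (a - b) * b ^ n := by ring
    have hb' : ‖b‖ ^ n ≤ M ^ n := by gcongr
    have hM' : M ^ n ≤ M ^ (n + 1) := pow_le_pow_right₀ hM (by omega)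
    calc ‖a ^ (n + 1) - b ^ (n + 1)‖ ≤ ‖a‖ * ‖a ^ n - b ^ n‖ + ‖a - b‖ * ‖b‖ ^ n := by
          rw [h1, ← norm_pow, ← norm_mul, ← norm_mul]
          exact norm_add_le _ _
      _ ≤ M * (n * M ^ n * ‖a - b‖) + ‖a - b‖ * M ^ (n + 1) := by
          gcongr
          exact hb'.trans hM'
      _ = _ := by push_cast; ring

theorem expCos_le (s : ℝ) (θ x : Circ) : expCos s θ x ≤ Real.exp |s| :=
  Real.exp_le_exp.2 <| (le_abs_self _).trans <| by
    rw [abs_mul]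
    exact mul_le_of_le_one_right (abs_nonneg _) (abs_angle_cos_le _)

theorem expCos_pow (s : ℝ) (θ x : Circ) (n : ℕ) : expCos s θ x ^ n = expCos (n * s) θ x := by
  rw [expCos, expCos, ← Real.exp_nat_mul, mul_assoc]

/-- Since `P = e^{s cos} + o(1/n)` uniformly for `s = κ / n`, the powers `P ^ n` converge uniformly
to `e^{κ cos}`. -/
theorem norm_evolvedTrunc_pow_sub_le (α : ℝ) (m : ℕ) (t : ℝ) {d : ℕ} (hd : 1 ≤ d) {κ δ : ℝ}
    (hκ : 0 < κ) {n : ℕ} (hn : 0 < n) (hκn : κ ≤ n)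
    (hδ : δ = κ * (2 * phaseError p τ α m t d + (2 * d + 2) * (κ / n))) (θ x : Circ) :
    ‖evolvedTrunc p τ α m t d (κ / n) θ x ^ n - (expCos κ (θ + ((α * t : ℝ) : Circ)) x : ℂ)‖ ≤
      Real.exp (κ + δ) * δ := by
  have hn' : (0 : ℝ) < n := by exact_mod_cast hn
  have hs0 : 0 < κ / n := div_pos hκ hn'
  have hs : |κ / n| ≤ 1 := by rw [abs_of_pos hs0]; exact (div_le_one hn').2 hκn
  have h1 := norm_evolvedTrunc_sub_le (p := p) (τ := τ) α m t hd hs θ x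
  have hE := expCos_le (κ / n) (θ + ((α * t : ℝ) : Circ)) x
  have hE0 := expCos_pos (κ / n) (θ + ((α * t : ℝ) : Circ)) x
  have hpow := expCos_pow (κ / n) (θ + ((α * t : ℝ) : Circ)) x n
  rw [mul_div_cancel₀ _ hn'.ne'] at hpow
  rw [abs_of_pos hs0] at h1 hE
  have hδ' : 2 * (κ / n) * phaseError p τ α m t d + (2 * d + 2) * (κ / n) ^ 2 = δ / n := by
    rw [hδ]
    field_simp
  rw [hδ'] at h1
  set P := evolvedTrunc p τ α m t d (κ / n) θ x
  set E := expCos (κ / n) (θ + ((α * t : ℝ) : Circ)) x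
  have hδ0 : 0 ≤ δ / n := (norm_nonneg _).trans h1
  have hexp : Real.exp (κ / n) + δ / n ≤ Real.exp (κ / n + δ / n) := by
    rw [Real.exp_add]
    have h2 := Real.add_one_le_exp (δ / n)
    have h3 : 1 ≤ Real.exp (κ / n) := Real.one_le_exp hs0.le
    nlinarith
  have hEn : ‖(E : ℂ)‖ = E := by rw [Complex.norm_real, Real.norm_of_nonneg hE0.le]
  have hM : 1 ≤ Real.exp (κ / n + δ / n) := Real.one_le_exp (by positivity)
  have hP : ‖P‖ ≤ Real.exp (κ / n + δ / n) := by
    have h2 := norm_add_le (P - E) (E : ℂ)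
    rw [sub_add_cancel, hEn] at h2
    linarith
  have h2 := norm_pow_sub_pow_le_of_norm_le hM hP (by rw [hEn]; linarith) n
  rw [← Complex.ofReal_pow, hpow, ← Real.exp_nat_mul] at h2
  refine h2.trans ?_
  have h3 : (n : ℝ) * (κ / n + δ / n) = κ + δ := by field_simp
  rw [h3]
  calc n * Real.exp (κ + δ) * ‖P - E‖ ≤ n * Real.exp (κ + δ) * (δ / n) := by gcongr
    _ = Real.exp (κ + δ) * δ := by field_simp

/-! ### The limit -/

theorem continuous_evolvedTrunc (α : ℝ) (m : ℕ) (t : ℝ) (d : ℕ) (s : ℝ) (θ : Circ) :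
    Continuous (evolvedTrunc p τ α m t d s θ) :=
  continuous_finsetSum _ fun i _ => continuous_const.mul (fourier (freq i)).continuous

theorem integrable_of_Lp_top (f : Lp ℂ ∞ haar) : Integrable f haar :=
  (Lp.memLp f).integrable le_top

/-- Invariance of the measure moves the rotation from `f` to the centre of the density. -/
theorem classicalExpectation_koopman (α t s : ℝ) (f : Lp ℂ ∞ haar) (θ : Circ) :
    classicalExpectation (vonMises θ s) (koopman α t f) =
      (∫ x, f x * (expCos s (θ + ((α * t : ℝ) : Circ)) x : ℂ) ∂haar) / (besselI 0 s : ℂ) := by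
  rw [classicalExpectation, ← integral_div]
  refine Eq.trans (integral_congr_ae ?_) (integral_add_right_eq_self (μ := haar)
    (fun x => f x * (expCos s (θ + ((α * t : ℝ) : Circ)) x : ℂ) / (besselI 0 s : ℂ))
    ((α * t : ℝ) : Circ))
  filter_upwards [koopman_coeFn α t f] with x hx
  rw [hx, flow, vonMises_eq, ← expCos_sub, add_sub_cancel_right]
  push_cast
  ring

/-- Averages with respect to `|P|^{2n}` converge to averages with respect to `e^{2κ cos}`. -/
theorem tendsto_integral_evolvedTrunc {ι : Type*} {l : Filter ι} [l.IsCountablyGenerated]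
    {τ : ι → PosReal} {n : ι → ℕ} (hτ : Tendsto (fun i => (τ i : ℝ)) l (𝓝 0))
    (hn : Tendsto n l atTop) (p : Exponent) (α t : ℝ) {m d : ℕ} (hd : 1 ≤ d)
    (hm : 2 * d + 1 ≤ m) {κ : ℝ} (hκ : 0 < κ) {f : Circ → ℂ} (hf : Integrable f haar) (θ : Circ) :
    Tendsto (fun e => ∫ x, f x *
        ((‖evolvedTrunc p (τ e) α m t d (κ / n e) θ x ^ n e‖ ^ 2 : ℝ) : ℂ) ∂haar) l
      (𝓝 (∫ x, f x * (expCos (2 * κ) (θ + ((α * t : ℝ) : Circ)) x : ℂ) ∂haar)) := by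
  set θ' : Circ := θ + ((α * t : ℝ) : Circ)
  have hn' : Tendsto (fun e => (n e : ℝ)) l atTop := tendsto_natCast_atTop_atTop.comp hn
  let δ : ι → ℝ := fun e =>
    κ * (2 * phaseError p (τ e) α m t d + (2 * d + 2) * (κ / n e))
  have hδ : Tendsto δ l (𝓝 0) := by
    have h := (((tendsto_phaseError hτ p α t hm).const_mul 2).add
      ((hn'.const_div_atTop κ).const_mul (2 * (d : ℝ) + 2))).const_mul κ
    simpa using h
  have hB : Tendsto (fun e => Real.exp (κ + δ e) * δ e) l (𝓝 0) := by
    have h := ((Real.continuous_exp.tendsto _).comp (hδ.const_add κ)).mul hδ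
    simpa using h
  have hclose : ∀ᶠ e in l, ∀ x, ‖evolvedTrunc p (τ e) α m t d (κ / n e) θ x ^ n e -
      (expCos κ θ' x : ℂ)‖ ≤ Real.exp (κ + δ e) * δ e := by
    filter_upwards [hn.eventually_gt_atTop 0, hn'.eventually_ge_atTop κ] with e h1 h2 x
    exact norm_evolvedTrunc_pow_sub_le α m t hd hκ h1 h2 rfl θ x
  have hEn : ∀ x, ‖(expCos κ θ' x : ℂ)‖ = expCos κ θ' x := fun x => by
    rw [Complex.norm_real, Real.norm_of_nonneg (expCos_pos _ _ _).le]
  refine tendsto_integral_filter_of_dominated_convergence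
    (fun x => ‖f x‖ * (Real.exp |κ| + 1) ^ 2) ?_ ?_ (hf.norm.mul_const _) ?_
  · refine Eventually.of_forall fun e => hf.aestronglyMeasurable.mul
      (Continuous.aestronglyMeasurable ?_)
    exact Complex.continuous_ofReal.comp
      (((continuous_evolvedTrunc α m t d _ θ).pow _).norm.pow 2)
  · filter_upwards [hclose, hB.eventually_le_const one_pos] with e he h1
    refine Eventually.of_forall fun x => ?_
    rw [norm_mul, Complex.norm_real, Real.norm_of_nonneg (by positivity)]
    gcongr
    have h2 := norm_le_norm_add_norm_sub' (evolvedTrunc p (τ e) α m t d (κ / n e) θ x ^ n e)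
      (expCos κ θ' x : ℂ)
    rw [hEn] at h2
    linarith [he x, expCos_le κ θ' x]
  · refine Eventually.of_forall fun x => Tendsto.const_mul _ ?_
    have h1 : Tendsto (fun e => evolvedTrunc p (τ e) α m t d (κ / n e) θ x ^ n e) l
        (𝓝 (expCos κ θ' x : ℂ)) := by
      rw [tendsto_iff_norm_sub_tendsto_zero]
      refine squeeze_zero' (Eventually.of_forall fun e => norm_nonneg _) ?_ hB
      filter_upwards [hclose] with e he
      exact he x
    have h2 : ‖(expCos κ θ' x : ℂ)‖ ^ 2 = expCos (2 * κ) θ' x := by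
      rw [hEn, expCos_pow]
      norm_num
    rw [← h2]
    exact (Complex.continuous_ofReal.tendsto _).comp (h1.norm.pow 2)

/-- The prediction converges along any `n → ∞` and `τ → 0`, with no relation between their rates. -/
theorem tendsto_fockPrediction {ι : Type*} {l : Filter ι} [l.IsCountablyGenerated]
    {τ : ι → PosReal} {n : ι → ℕ} (hτ : Tendsto (fun i => (τ i : ℝ)) l (𝓝 0))
    (hn : Tendsto n l atTop) {p : Exponent} {α : ℝ} (hα : α ≠ 0) (t : ℝ) {m d : ℕ} (hd : 1 ≤ d)
    (hm : 2 * d + 1 ≤ m) {κ : ℝ} (hκ : 0 < κ) {w : ℕ+ → ℝ} (hw : Summable w)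
    (hw0 : ∀ n, 0 < w n) {ζ : (τ : PosReal) → Fin m → RKHA p τ}
    (hζ : ∀ τ, IsEigenbasis p τ α m (ζ τ)) (f : Lp ℂ ∞ haar) (θ : Circ) :
    Tendsto (fun e => fockPrediction α t w κ (n e) d m (ζ (τ e)) f θ) l
      (𝓝 (classicalExpectation (vonMises θ (2 * κ)) (koopman α t f))) := by
  have h1 := tendsto_integral_evolvedTrunc hτ hn p α t hd hm hκ (integrable_of_Lp_top f) θ
  have h2 := tendsto_integral_evolvedTrunc hτ hn p α t hd hm hκ
    (integrable_const (1 : ℂ) : Integrable (fun _ : Circ => (1 : ℂ)) haar) θ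
  simp only [one_mul] at h2
  rw [integral_complex_ofReal, integral_expCos] at h2
  have hI : (besselI 0 (2 * κ) : ℂ) ≠ 0 := by exact_mod_cast (besselI_zero_pos (2 * κ)).ne'
  rw [classicalExpectation_koopman]
  refine (h1.div h2 hI).congr' ?_
  filter_upwards [eventually_eigFreq_ne hτ p hα m, hn.eventually_gt_atTop 0] with e he hne
  exact (fockPrediction_eq (hζ (τ e)) hm he hw hw0 t κ hne f θ).symm

end FockKoopman

end

open FockKoopman

theorem mainTheorem1 (p : Exponent) (α : ℝ) (hα : α ≠ 0) (f : Lp ℂ ∞ haar) :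
    ∃ c₁ c₂ : PosReal, ∀ (t : ℝ) (κ : PosReal) (m : ℕ) (_ : 2 * 2 + 1 ≤ m)
      (w : ℕ+ → ℝ) (_ : ∀ n, 0 < w n) (_ : HasSum w 1)
      (ζ : (τ : PosReal) → Fin m → RKHA p τ) (_ : ∀ τ, IsEigenbasis p τ α m (ζ τ)) (θ : Circ),
      Tendsto
        (fun ε : PosReal =>
          fockPrediction α t w κ ⌈(c₁ : ℝ) / ε⌉₊ 2 m (ζ (c₂ * ε ^ 2)) f θ)
        (comap Subtype.val (𝓝 0))
        (𝓝 (classicalExpectation (vonMises θ (2 * κ)) (koopman α t f))) := by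
  -- The limit needs only `n → ∞` and `τ → 0`, whatever the rates.
  refine ⟨1, 1, fun t κ m hm w hw0 hw ζ hζ θ => ?_⟩
  have hε : Tendsto (fun ε : PosReal => (ε : ℝ)) (comap Subtype.val (𝓝 0)) (𝓝 0) := tendsto_comap
  have hτ : Tendsto (fun ε : PosReal => (((1 : PosReal) * ε ^ 2 : PosReal) : ℝ))
      (comap Subtype.val (𝓝 0)) (𝓝 0) := by
    simpa using hε.pow 2
  have hn : Tendsto (fun ε : PosReal => ⌈((1 : PosReal) : ℝ) / ε⌉₊)
      (comap Subtype.val (𝓝 0)) atTop := by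
    have hε' : Tendsto (fun ε : PosReal => (ε : ℝ)) (comap Subtype.val (𝓝 0)) (𝓝[>] 0) :=
      tendsto_nhdsWithin_iff.2 ⟨hε, Eventually.of_forall fun ε => ε.2⟩
    have h := tendsto_inv_nhdsGT_zero.comp hε'
    refine tendsto_nat_ceil_atTop.comp (h.congr fun ε => ?_)
    simp
  exact tendsto_fockPrediction hτ hn hα t one_le_two hm κ.2 hw.summable hw0 hζ f θ
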